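/- **Setting.** Let $n\ge 2$, let $\mathcal O_k=\{q\in\mathbb R^n:\|q-c_k\|\le r_k\}$, $k\in\mathbb I=\{1,\dots,b\}$, $r_k>0$, be balls with $\|c_k-c_j\|>r_k+r_j$ for $k\ne j$, let $\mathcal X=\mathbb R^n\setminus\bigcup_k\mathring{\mathcal O}_k$ and $x_d\in\mathring{\mathcal X}$. For $q\in\mathcal X$ put $\theta(q,k)=\arcsin(r_k/\|q-c_k\|)$. For $y\in\mathcal X$ let $$\mathcal S_k(y)=\{q\in\mathcal X\setminus\{y\}:\ (c_k-y)^\top(q-y)\ge\|c_k-y\|\|q-y\|\cos\theta(y,k),\ (c_k-q)^\top(y-q)\ge 0\}$$ be the region hidden from $y$ by $\mathcal O_k$, and $\mathcal A_k(y)=\mathcal S_k(y)\cap\{q:\|q-c_k\|\le r_k+\bar r_k\}$ the active region. Here $0<\bar r_k<\|c_k-c_j\|-r_k-r_j$ for all $j\neq k$ with $\mathcal S_k(x_d)\cap\partial\mathcal O_j\ne\varnothing$. Let $\gamma>0$, $e_k>0$ and $0<\epsilon\le\min_k\bar r_k$. *Virtual destinations.* With $p_k=c_k+r_k\frac{x_d-c_k}{\|x_d-c_k\|}$,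 the point $x_k^1$ lies on the part outside $\mathcal A_k(x_d)$ of the surface in $\mathcal X$ of the cone with vertex $x_d$ enclosing $\mathcal O_k$, and satisfies $(x_d-p_k)^\top(x_k^1-p_k)\ge0$ and $\|x_d-x_k^1\|=e_k$; $x_k^{-1}$ is the mirror image of $x_k^1$ in the line through $x_d$ and $c_k$. Put $v_k^m=c_k-x_k^m$ and fix $0<\varphi_k<\min\{\tfrac12\angle(v_k^1,v_k^{-1}),\tfrac12(\pi-\angle(v_k^1,v_k^{-1}))\}$. *Control.* The state is $(x,k,m)$ with $m\in\{-1,0,1\}$, together with the current virtual destinations. The velocity input is $$u(x,k,m)=m^2\alpha\mu\,\kappa(x,k,m)+(1-m^2\alpha)\gamma(x_d-x),$$ where $\bar\kappa=\gamma(x_k^m-x)$, $\beta=\angle(c_k-x,\bar\kappa)$, $\theta=\theta(x,k)$, $\kappa=\bar\kappa-\|\bar\kappa\|\frac{\sin(\theta-\beta)}{\sin\theta}\frac{c_k-x}{\|c_k-x\|}$, $\mu=1+\frac{e_k}{\|x-x_k^m\|}\frac{\beta}{\theta}$, and $\alpha=\alpha(x,k)$ equals $1$ if $d(x,\mathcal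 O_k)<\bar r_k-\epsilon$, $(\bar r_k-d(x,\mathcal O_k))/\epsilon$ if $\bar r_k-\epsilon\le d(x,\mathcal O_k)\le\bar r_k$, and $0$ otherwise. *Hybrid dynamics.* Flow $\dot x=u$, with all other components constant, is allowed in mode $0$ for $x\in\tilde{\mathcal F}_0=\bigcap_k\overline{\mathcal X\setminus\mathcal A_k(x_d)}$, and in mode $m=\pm1$ for $x\in\mathcal F_k^m=\mathcal A_k(x_k^m)\setminus\{q:(v_k^m)^\top(q-c_k)>\|v_k^m\|\|q-c_k\|\cos\varphi_k\}$. In mode $m=\pm1$ with $x\in\overline{\mathcal X\setminus\mathcal F_k^m}$ the mode may jump to $0$ ($k$ unchanged). In mode $0$ with $x\in\mathcal A_{k}(x_d)$ for some $k$, that obstacle may be selected; then virtual destinations $x_k^{\pm1}$ are chosen in the plane through $x_d,c_k$ and the current (entry) position $x$ (in the plane through $x_d,c_k,y$ for some $y$ off the line through $x_d$ and $c_k$, if $x$ is on that line), and the mode jumps to an element of $\hat B(x,k)$. Let $C^m=\{q:(v_k^m)^\top(q-c_k)\le\|v_k^m\|\|q-c_k\|\cos\varphi_k\}$ and $s=(x_k^{-1}-x_k^1)^\top(x-c_k)$.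 If $x$ lies in exactly one of $C^1$ and $C^{-1}$, then $\hat B(x,k)$ is the index of that one; if $x\in C^1\cap C^{-1}$, it is $\{1\}$ for $s<0$, $\{-1\}$ for $s>0$ and $\{-1,1\}$ for $s=0$ (the closest virtual destination is picked). **Proposition.** Consider any solution of this hybrid system (in the sense of hybrid time domains and locally absolutely continuous arcs) that starts in mode $0$, or in a state obtained by a jump from mode $0$. Then: 1. The velocity input is continuous: there is a continuous function $U$ of ordinary time $t$ with $u(x(t,j),k(t,j),m(t,j))=U(t)$ for all hybrid times $(t,j)$ of the solution, before and after each jump; only $(t,j)=(0,0)$ is excepted, and only if the initial state is outside the flow set (the robot starts inside an active region in mode $0$ and switches immediately). 2. Each obstacle-avoidance maneuver is locally optimal: at every hybrid time with $m=\pm1$, the vector $w=\kappa(x,k,m)$ is nonzero, is tangent to $\mathcal O_k$, i.e. $w^\top(c_k-x)=\|w\|\|c_k-x\|\cos\theta(x,k)$, and has the smallest angle with $x_d-x$ among all nonzero vectors with this property. Where moreover $d(x,\mathcal O_k)\le\bar r_k-\epsilon$, the same holds for the velocity $w=u(x,k,m)$ itself. -/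

import Mathlib

noncomputable section

namespace HybridNav

/-- Points (and vectors) of the Euclidean space of dimension `n`. -/
abbrev Pt (n : ℕ) : Type := EuclideanSpace ℝ (Fin n)

/-! ### Elementary geometry -/

/-- The closed positive half-space through `x` with normal `v`. -/
def halfSpaceGE {n : ℕ} (x v : Pt n) : Set (Pt n) := {q | 0 ≤ inner ℝ v (q - x)}

/-- The open positive half-space through `x` with normal `v`. -/
def halfSpaceGT {n : ℕ} (x v : Pt n) : Set (Pt n) := {q | 0 < inner ℝ v (q - x)}

/-- The open negative half-space through `x` with normal `v`. -/
def halfSpaceLT {n : ℕ} (x v : Pt n) : Set (Pt n) := {q | inner ℝ v (q - x) < 0}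

/-- The hyperplane through `x` with normal `v`. -/
def hyperplane {n : ℕ} (x v : Pt n) : Set (Pt n) := {q | inner ℝ v (q - x) = 0}

/-- The solid cone (boundary included) inside `A` with vertex `x`, axis `v`, half aperture `φ`. -/
def coneLE {n : ℕ} (A : Set (Pt n)) (x v : Pt n) (φ : ℝ) : Set (Pt n) :=
  {q | q ∈ A ∧ ‖v‖ * ‖q - x‖ * Real.cos φ ≤ inner ℝ v (q - x)}

/-- The interior of the cone, inside `A`. -/
def coneLT {n : ℕ} (A : Set (Pt n)) (x v : Pt n) (φ : ℝ) : Set (Pt n) :=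
  {q | q ∈ A ∧ ‖v‖ * ‖q - x‖ * Real.cos φ < inner ℝ v (q - x)}

/-- The surface of the cone, inside `A`. -/
def coneEQ {n : ℕ} (A : Set (Pt n)) (x v : Pt n) (φ : ℝ) : Set (Pt n) :=
  {q | q ∈ A ∧ ‖v‖ * ‖q - x‖ * Real.cos φ = inner ℝ v (q - x)}

/-- The exterior of the cone (boundary included), inside `A`. -/
def coneGE {n : ℕ} (A : Set (Pt n)) (x v : Pt n) (φ : ℝ) : Set (Pt n) :=
  {q | q ∈ A ∧ inner ℝ v (q - x) ≤ ‖v‖ * ‖q - x‖ * Real.cos φ}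

/-- The vectors parallel to the surface of a cone with axis `v` and half aperture `φ`. -/
def parallelCone {n : ℕ} (v : Pt n) (φ : ℝ) : Set (Pt n) :=
  {w | inner ℝ w v = ‖w‖ * ‖v‖ * Real.cos φ}

/-- The elementary reflector `I - 2 v vᵀ` applied to `w`. -/
def reflector {n : ℕ} (v w : Pt n) : Pt n := w - (2 * inner ℝ v w) • v

/-- The plane through `y` spanned by `q₁ - y` and `q₂ - y`. -/
def planeThrough {n : ℕ} (q₁ q₂ y : Pt n) : Set (Pt n) := affineSpan ℝ {q₁, q₂, y}

/-- The line through `x` and `y`. -/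
def lineThrough {n : ℕ} (x y : Pt n) : Set (Pt n) := {q | ∃ t : ℝ, q = x + t • (y - x)}

/-! ### The workspace and the design parameters -/

/-- The data of the navigation problem: centers `c` and radii `r` of the obstacles, destination
`xd`, ranges `rbar` of the active regions, width `ε` of the smoothing layers, gain `γ`, distances
`e` from the destination to the virtual destinations, and half apertures `φ` of the cones that are
removed from the flow sets of the obstacle-avoidance modes. -/
structure Workspace (n b : ℕ) where
  c : Fin b → Pt n
  r : Fin b → ℝ
  xd : Pt n
  rbar : Fin b → ℝ
  ε : ℝ
  γ : ℝ
  e : Fin b → ℝ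
  φ : Fin b → ℝ

namespace Workspace

variable {n b : ℕ} (W : Workspace n b)

/-- The obstacle with index `k`. -/
def obstacle (k : Fin b) : Set (Pt n) := Metric.closedBall (W.c k) (W.r k)

/-- The obstacle-free space. -/
def freeSpace : Set (Pt n) := Set.univ \ ⋃ k, interior (W.obstacle k)

/-- Half aperture of the cone with vertex `q` enclosing the obstacle `k`. -/
def theta (q : Pt n) (k : Fin b) : ℝ := Real.arcsin (W.r k / ‖q - W.c k‖)

/-- The region hidden from the point `y` by the obstacle `k`. The vertex `y` of the cone is not
hidden from itself. -/
def shadow (k : Fin b) (y : Pt n) : Set (Pt n) :=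
  {q | q ∈ coneLE W.freeSpace y (W.c k - y) (W.theta y k) ∧
    0 ≤ inner ℝ (W.c k - q) (y - q) ∧ q ≠ y}

/-- The active region of the obstacle `k` with respect to the point `y`. -/
def active (k : Fin b) (y : Pt n) : Set (Pt n) :=
  W.shadow k y ∩ Metric.closedBall (W.c k) (W.r k + W.rbar k)

/-- The other obstacles that the obstacle `k` hides, fully or partially, from the destination. -/
def hidden (k : Fin b) : Set (Fin b) :=
  {j | j ≠ k ∧ (W.shadow k W.xd ∩ frontier (W.obstacle j)).Nonempty}

/-- The exit set: the lateral surface of the active region. -/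
def exitSet (k : Fin b) (y : Pt n) : Set (Pt n) :=
  coneEQ W.freeSpace y (W.c k - y) (W.theta y k) ∩ W.active k y

/-- The hat: the surface of the enclosing cone without the exit set. -/
def hat (k : Fin b) (y : Pt n) : Set (Pt n) :=
  coneEQ W.freeSpace y (W.c k - y) (W.theta y k) \ W.exitSet k y

/-- The point of the obstacle `k` closest to the destination. -/
def nearPoint (k : Fin b) : Pt n :=
  W.c k + (W.r k / ‖W.xd - W.c k‖) • (W.xd - W.c k)

/-! ### Virtual destinations -/

/-- `z` can be chosen as the virtual destination `x_k^1`. -/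
def IsVirtualDest (k : Fin b) (z : Pt n) : Prop :=
  z ∈ W.hat k W.xd ∩ halfSpaceGE (W.nearPoint k) (W.xd - W.nearPoint k) ∧ ‖W.xd - z‖ = W.e k

/-- The virtual destination `x_k^m`, `m = ±1`, when `x_k^1 = z`; `x_k^{-1}` is the mirror image of
`x_k^1` in the axis of the hat. The value at `m = 0` is not used. -/
def virtualDest (k : Fin b) (z : Pt n) : SignType → Pt n
  | 1 => z
  | -1 => W.xd - reflector (‖W.c k - W.xd‖⁻¹ • (W.c k - W.xd)) (z - W.xd)
  | 0 => W.xd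

/-- The axis `v_k^m = c_k - x_k^m`. -/
def vaxis (k : Fin b) (z : Pt n) (m : SignType) : Pt n := W.c k - W.virtualDest k z m

/-- `z` is an admissible choice of `x_k^1` when the obstacle `k` is selected at the position `x`:
the virtual destinations lie in the plane of `xd`, `c_k` and `x`, or, when these three points are
aligned, in the plane of `xd`, `c_k` and some point `y` off their line. -/
def IsPlanarVirtualDest (k : Fin b) (x z : Pt n) : Prop :=
  W.IsVirtualDest k z ∧
    ∃ y, y ∉ lineThrough W.xd (W.c k) ∧ (x ∉ lineThrough W.xd (W.c k) → y = x) ∧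
      ∀ m : SignType, m ≠ 0 → W.virtualDest k z m ∈ planeThrough W.xd (W.c k) y

/-- The standing assumptions on the workspace and on the design parameters. -/
structure Valid : Prop where
  r_pos : ∀ k, 0 < W.r k
  disjoint : ∀ k j, k ≠ j → W.r k + W.r j < ‖W.c k - W.c j‖
  xd_mem : W.xd ∈ interior W.freeSpace
  rbar_pos : ∀ k, 0 < W.rbar k
  rbar_lt : ∀ k, ∀ j ∈ W.hidden k, W.rbar k < ‖W.c k - W.c j‖ - W.r k - W.r j
  ε_pos : 0 < W.ε
  ε_le : ∀ k, W.ε ≤ W.rbar k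
  γ_pos : 0 < W.γ
  e_pos : ∀ k, 0 < W.e k
  φ_pos : ∀ k, 0 < W.φ k
  φ_lt : ∀ k z, W.IsVirtualDest k z →
    W.φ k < min (InnerProductGeometry.angle (W.vaxis k z 1) (W.vaxis k z (-1)) / 2)
      ((Real.pi - InnerProductGeometry.angle (W.vaxis k z 1) (W.vaxis k z (-1))) / 2)

/-! ### The control law -/

/-- The nominal control of the motion-to-destination mode. -/
def nominal (x : Pt n) : Pt n := -(W.γ • (x - W.xd))

/-- The nominal control towards the virtual destination. -/
def kappaBar (x : Pt n) (k : Fin b) (z : Pt n) (m : SignType) : Pt n :=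
  W.γ • (W.virtualDest k z m - x)

/-- The angle between the directions to the center and to the virtual destination. -/
def beta (x : Pt n) (k : Fin b) (z : Pt n) (m : SignType) : ℝ :=
  InnerProductGeometry.angle (W.c k - x) (W.kappaBar x k z m)

def tau (x : Pt n) (k : Fin b) (z : Pt n) (m : SignType) : ℝ :=
  ‖W.kappaBar x k z m‖ * Real.sin (W.theta x k - W.beta x k z m) / Real.sin (W.theta x k)

/-- The control of the obstacle-avoidance mode. -/
def kappa (x : Pt n) (k : Fin b) (z : Pt n) (m : SignType) : Pt n :=
  W.kappaBar x k z m - W.tau x k z m • (‖W.c k - x‖⁻¹ • (W.c k - x))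

/-- The smoothing function `μ`; `e_k` is the distance of the virtual destinations to `xd`. -/
def mu (x : Pt n) (k : Fin b) (z : Pt n) (m : SignType) : ℝ :=
  1 + W.e k / ‖x - W.virtualDest k z m‖ * (W.beta x k z m / W.theta x k)

/-- The distance from `x` to the obstacle `k`. -/
def dist (x : Pt n) (k : Fin b) : ℝ := Metric.infDist x (W.obstacle k)

open Classical in
/-- The smoothing function `α`. -/
def alpha (x : Pt n) (k : Fin b) : ℝ :=
  if W.dist x k < W.rbar k - W.ε then 1
  else if W.dist x k ≤ W.rbar k then (W.rbar k - W.dist x k) / W.ε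
  else 0

end Workspace

/-! ### The hybrid closed-loop system -/

/-- The state: position, selected obstacle, mode, and the virtual destination `x_k^1` that was
chosen when the selected obstacle was last selected for avoidance. -/
structure State (n b : ℕ) where
  pos : Pt n
  obs : Fin b
  mode : SignType
  vdest : Pt n

namespace Workspace

variable {n b : ℕ} (W : Workspace n b)

/-- The velocity input. -/
def velocity (s : State n b) : Pt n :=
  ((s.mode : ℝ) ^ 2 * W.alpha s.pos s.obs * W.mu s.pos s.obs s.vdest s.mode) •
      W.kappa s.pos s.obs s.vdest s.mode +
    (1 - (s.mode : ℝ) ^ 2 * W.alpha s.pos s.obs) • W.nominal s.pos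

/-- Positions where the motion-to-destination mode may flow. -/
def flowDest : Set (Pt n) := ⋂ k, closure (W.freeSpace \ W.active k W.xd)

/-- Positions where the mode `m = ±1` may flow, for the obstacle `k` and `x_k^1 = z`. -/
def flowAvoid (k : Fin b) (z : Pt n) (m : SignType) : Set (Pt n) :=
  W.active k (W.virtualDest k z m) \ coneLT W.freeSpace (W.c k) (W.vaxis k z m) (W.φ k)

/-- Positions where the mode `m = ±1` may be left, for the obstacle `k` and `x_k^1 = z`. -/
def jumpAvoid (k : Fin b) (z : Pt n) (m : SignType) : Set (Pt n) :=
  closure (W.freeSpace \ W.flowAvoid k z m)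

/-- The flow set. -/
def flowSet : Set (State n b) :=
  {s | (s.mode = 0 ∧ s.pos ∈ W.flowDest) ∨
    (s.mode ≠ 0 ∧ s.pos ∈ W.flowAvoid s.obs s.vdest s.mode)}

/-- The jump set. -/
def jumpSet : Set (State n b) :=
  {s | (s.mode = 0 ∧ s.pos ∈ ⋃ k, W.active k W.xd) ∨
    (s.mode ≠ 0 ∧ s.pos ∈ W.jumpAvoid s.obs s.vdest s.mode)}

/-- The exterior of the excluded cone of the mode `m`. -/
def outerCone (k : Fin b) (z : Pt n) (m : SignType) : Set (Pt n) :=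
  coneGE Set.univ (W.c k) (W.vaxis k z m) (W.φ k)

/-- The modified mode-switching map: where both obstacle-avoidance modes are possible, the mode of
the closest virtual destination is selected. -/
def Bhat (x : Pt n) (k : Fin b) (z : Pt n) : Set SignType :=
  let C₁ := W.outerCone k z 1 \ W.outerCone k z (-1)
  let C₂ := W.outerCone k z (-1) \ W.outerCone k z 1
  let C := W.outerCone k z 1 ∩ W.outerCone k z (-1)
  let d := W.virtualDest k z (-1) - W.virtualDest k z 1
  {m | (m = 1 ∧ x ∈ C₁ ∪ (C ∩ halfSpaceLT (W.c k) d)) ∨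
    (m = -1 ∧ x ∈ C₂ ∪ (C ∩ halfSpaceGT (W.c k) d)) ∨
    ((m = 1 ∨ m = -1) ∧ x ∈ C ∩ hyperplane (W.c k) d)}

/-- The jump map, as a set-valued map. From an obstacle-avoidance mode, the mode is reset to `0`.
From the motion-to-destination mode, an obstacle whose active region contains the position is
selected, its virtual destinations are chosen in the plane of the destination, the center and the
position, and the mode is updated by `Bhat`. -/
def jumpMap (s : State n b) : Set (State n b) :=
  {s' | s'.pos = s.pos ∧
    ((s.mode ≠ 0 ∧ s.pos ∈ W.jumpAvoid s.obs s.vdest s.mode ∧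
        s'.obs = s.obs ∧ s'.mode = 0 ∧ s'.vdest = s.vdest) ∨
      (s.mode = 0 ∧ s.pos ∈ W.active s'.obs W.xd ∧
        W.IsPlanarVirtualDest s'.obs s.pos s'.vdest ∧
        s'.mode ∈ W.Bhat s.pos s'.obs s'.vdest))}

end Workspace

/-! ### Solutions of hybrid systems -/

/-- A compact hybrid time domain: a finite union of `[τ_j, τ_{j+1}] × {j}`, `j < J`, with
`0 = τ_0 ≤ τ_1 ≤ ⋯`. -/
def IsCompactHybridTimeDomain (T : Set (ℝ × ℕ)) : Prop :=
  ∃ (J : ℕ) (τ : ℕ → ℝ), τ 0 = 0 ∧ Monotone τ ∧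
    T = {p | p.2 < J ∧ p.1 ∈ Set.Icc (τ p.2) (τ (p.2 + 1))}

/-- A hybrid time domain: each truncation is a compact hybrid time domain. -/
def IsHybridTimeDomain (T : Set (ℝ × ℕ)) : Prop :=
  (∀ p ∈ T, 0 ≤ p.1) ∧
    ∀ p ∈ T, IsCompactHybridTimeDomain (T ∩ (Set.Icc 0 p.1 ×ˢ Set.Iic p.2))

/-- The times that belong to the index `j`. -/
def timeSlice (T : Set (ℝ × ℕ)) (j : ℕ) : Set ℝ := {t | (t, j) ∈ T}

/-- `ξ` is a solution, with the hybrid time domain `T`, of the closed-loop system: on each time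
slice the position is locally absolutely continuous, its derivative is the velocity input almost
everywhere, the other components are constant, and the state is in the flow set on the interior of
the slice; at each jump the state is in the jump set and is updated by the jump map. -/
structure Workspace.IsSolution {n b : ℕ} (W : Workspace n b) (T : Set (ℝ × ℕ))
    (ξ : ℝ → ℕ → State n b) : Prop where
  domain : IsHybridTimeDomain T
  zero_mem : ((0 : ℝ), (0 : ℕ)) ∈ T
  init : ξ 0 0 ∈ W.flowSet ∪ W.jumpSet
  absCont : ∀ j a d, Set.uIcc a d ⊆ timeSlice T j →
    AbsolutelyContinuousOnInterval (fun t => (ξ t j).pos) a d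
  const : ∀ j, ∀ t ∈ timeSlice T j, ∀ t' ∈ timeSlice T j,
    (ξ t j).obs = (ξ t' j).obs ∧ (ξ t j).mode = (ξ t' j).mode ∧ (ξ t j).vdest = (ξ t' j).vdest
  flow_mem : ∀ j, ∀ t ∈ interior (timeSlice T j), ξ t j ∈ W.flowSet
  flow_deriv : ∀ j, ∀ᵐ t : ℝ, t ∈ interior (timeSlice T j) →
    HasDerivAt (fun τ => (ξ τ j).pos) (W.velocity (ξ t j)) t
  jump : ∀ t j, (t, j) ∈ T → (t, j + 1) ∈ T →
    ξ t j ∈ W.jumpSet ∧ ξ t (j + 1) ∈ W.jumpMap (ξ t j)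

/-! ### Local optimality -/

/-- The nonzero vector `w`, applied at the position `x`, is tangent to the obstacle `k` (parallel
to the surface of the cone with vertex `x` enclosing the obstacle), and among all such vectors it
makes the smallest angle with the direction to the destination. -/
def Workspace.IsLocallyOptimal {n b : ℕ} (W : Workspace n b) (x : Pt n) (k : Fin b) (w : Pt n) :
    Prop :=
  w ≠ 0 ∧ w ∈ parallelCone (W.c k - x) (W.theta x k) ∧
    ∀ v ∈ parallelCone (W.c k - x) (W.theta x k), v ≠ 0 →
      InnerProductGeometry.angle (W.xd - x) w ≤ InnerProductGeometry.angle (W.xd - x) v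

end HybridNav

end

/-! A maneuver is planar. The virtual destinations lie in the plane of the destination, the center
and the entry position, and the control only combines vectors between these points and the position.
In that plane, put the center at the origin and let the common tangent from the destination and the
virtual destination be the line `P = r`: the destination is `(r, H)`, the virtual destination is
`(r, h)`, and `H = h + e` (`IsTangential.exists_tangentFrame`).

The invariant is that the position stays in the half region `P ≤ r`, `q ≤ 0`, `r q ≤ H P` of the
active region. The mode-switching map selects this side of the axis (`exists_maneuver`). Along the
flow, the component of the position normal to the axis solves a linear equation with nonnegative
forcing, so it keeps its sign (`inner_nonneg_of_flow`); membership in the flow set then gives `P ≤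
r` and `q ≤ 0` (`Maneuver.flow`).

Continuity: apart from the exceptional initial state, the mode changes only where `P = r` or on the
outer sphere of the active region. If `P = r`, then `β = θ`, the correction `τ` vanishes and `μ = (H
- q) / (h - q)` rescales `γ (z - x)` to `γ (xd - x)`, where `z` is the virtual destination. On the
outer sphere `α = 0`. Either way the control is the nominal one (`Maneuver.velocity_eq_nominal`). A
reset may be followed at once by a new selection; since active regions of different obstacles are
disjoint (`eq_of_mem_active`), the position is still on such a boundary.

Optimality: in the half region `xd - x` is a nonnegative multiple of `κ` plus a multiple of `c - x`.
Unit tangent vectors all have the same inner product with `c - x`, so Cauchy–Schwarz makes `κ` the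
best of them. -/

noncomputable section

namespace HybridNav

open Set Filter Topology MeasureTheory

/-! ### A Grönwall-type sign principle for absolutely continuous functions -/

/-- A function that is nonnegative at `a` and whose derivative is at least `K` times the function
wherever the function is negative is nonnegative at `b`. -/
theorem nonneg_of_deriv_ge {f : ℝ → ℝ} {a b K : ℝ} (hab : a ≤ b)
    (hf : AbsolutelyContinuousOnInterval f a b) (h0 : 0 ≤ f a)
    (hd : ∀ᵐ t : ℝ, t ∈ Ioo a b → f t < 0 → ∃ f', HasDerivAt f f' t ∧ K * f t ≤ f') :
    0 ≤ f b := by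
  by_contra! hb
  have hcont : ContinuousOn f (Icc a b) := by simpa [uIcc_of_le hab] using hf.continuousOn
  have hcl : IsClosed (Icc a b ∩ f ⁻¹' Ici 0) :=
    hcont.preimage_isClosed_of_isClosed isClosed_Icc isClosed_Ici
  have hcomp : IsCompact (Icc a b ∩ f ⁻¹' Ici 0) :=
    isCompact_Icc.of_isClosed_subset hcl inter_subset_left
  -- Take the last time `s` with `f s ≥ 0`. After it `f` is negative, so `f t * exp (-K t)` has
  -- nonnegative derivative and cannot decrease from a nonnegative to a negative value.
  obtain ⟨s, ⟨⟨has, hsb⟩, hfs⟩, hs⟩ := hcomp.exists_isGreatest ⟨a, ⟨le_rfl, hab⟩, h0⟩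
  have hneg : ∀ t ∈ Ioc s b, f t < 0 := fun t ht => by
    by_contra! h
    exact absurd (hs ⟨⟨has.trans ht.1.le, ht.2⟩, h⟩) (not_le.2 ht.1)
  have hexp : AbsolutelyContinuousOnInterval (fun t => Real.exp (-K * t)) s b :=
    ContDiffOn.absolutelyContinuousOnInterval (by fun_prop)
  have hg := (hf.mono (c := s) (d := b)
    (by rw [uIcc_of_le hsb, uIcc_of_le hab]; exact Icc_subset_Icc_left has)).fun_mul hexp
  have hint := hg.integral_deriv_eq_sub
  have hnn : 0 ≤ ∫ t in s..b, deriv (fun t => f t * Real.exp (-K * t)) t := by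
    apply intervalIntegral.integral_nonneg_of_ae_restrict hsb
    rw [EventuallyLE, ae_restrict_iff' measurableSet_Icc]
    have hnb : ∀ᵐ t : ℝ, t ≠ b := by simp [ae_iff, measure_singleton]
    have hns : ∀ᵐ t : ℝ, t ≠ s := by simp [ae_iff, measure_singleton]
    filter_upwards [hd, hnb, hns] with t ht h1 h2 h3
    have hts : s < t := lt_of_le_of_ne h3.1 (Ne.symm h2)
    have htb : t < b := lt_of_le_of_ne h3.2 h1
    obtain ⟨f', hf', hle⟩ := ht ⟨has.trans_lt hts, htb⟩ (hneg t ⟨hts, htb.le⟩)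
    have hE : HasDerivAt (fun t => Real.exp (-K * t)) (Real.exp (-K * t) * (-K * 1)) t :=
      ((hasDerivAt_id t).const_mul (-K)).exp
    rw [(hf'.fun_mul hE).deriv]
    have := Real.exp_pos (-K * t)
    have h4 := mul_nonneg this.le (sub_nonneg.2 hle)
    simp only [Pi.zero_apply]
    nlinarith
  have h1 : f b * Real.exp (-K * b) < 0 := mul_neg_of_neg_of_pos hb (Real.exp_pos _)
  have h2 : 0 ≤ f s * Real.exp (-K * s) := mul_nonneg hfs (Real.exp_pos _).le
  linarith

/-- Absolute continuity is preserved by postcomposition with an affine functional. -/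
theorem absolutelyContinuousOnInterval_inner_sub {E : Type*} [NormedAddCommGroup E]
    [InnerProductSpace ℝ E] {f : ℝ → E} {a b : ℝ} (hf : AbsolutelyContinuousOnInterval f a b)
    (v c : E) : AbsolutelyContinuousOnInterval (fun t => inner ℝ v (f t - c)) a b := by
  rw [absolutelyContinuousOnInterval_iff] at hf ⊢
  intro ε hε
  -- The summand `1` covers `v = 0`.
  obtain ⟨δ, hδ, h⟩ := hf (ε / (‖v‖ + 1)) (by positivity)
  refine ⟨δ, hδ, fun E hE hlt => ?_⟩
  have h1 := h E hE hlt
  rw [lt_div_iff₀ (by positivity)] at h1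
  refine lt_of_le_of_lt ?_ h1
  rw [Finset.sum_mul]
  refine Finset.sum_le_sum fun i _ => ?_
  rw [Real.dist_eq, ← _root_.inner_sub_right, sub_sub_sub_cancel_right, dist_eq_norm]
  calc _ ≤ ‖v‖ * ‖f (E.2 i).1 - f (E.2 i).2‖ := abs_real_inner_le_norm _ _
    _ ≤ _ := by nlinarith [norm_nonneg (f (E.2 i).1 - f (E.2 i).2)]

/-! ### Hybrid time domains -/

variable {T : Set (ℝ × ℕ)}

/-- The times with index `j` that precede a given one form an interval, which starts at `0` or at a
jump time. -/
theorem IsHybridTimeDomain.exists_start (hT : IsHybridTimeDomain T) {t : ℝ} {j : ℕ}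
    (h : (t, j) ∈ T) : ∃ s ≤ t, Icc s t ⊆ timeSlice T j ∧ (j = 0 → s = 0) ∧
      ∀ i, j = i + 1 → (s, i) ∈ T := by
  obtain ⟨J, τ, h0, hmono, hE⟩ := hT.2 _ h
  have hmem : ∀ (s : ℝ) (i : ℕ), i < J → τ i ≤ s → s ≤ τ (i + 1) → (s, i) ∈ T := by
    intro s i h1 h2 h3
    have : ((s, i) : ℝ × ℕ) ∈ {p : ℝ × ℕ | p.2 < J ∧ p.1 ∈ Icc (τ p.2) (τ (p.2 + 1))} :=
      ⟨h1, h2, h3⟩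
    rw [← hE] at this
    exact this.1
  have hm : ((t, j) : ℝ × ℕ) ∈ T ∩ (Icc 0 t ×ˢ Iic j) :=
    ⟨h, ⟨hT.1 _ h, le_rfl⟩, mem_Iic.2 le_rfl⟩
  rw [hE] at hm
  obtain ⟨hj, h1, h2⟩ := hm
  refine ⟨τ j, h1, fun s hs => hmem s j hj hs.1 (hs.2.trans h2), fun h => by rw [h, h0], ?_⟩
  rintro i rfl
  exact hmem _ i (by simp at hj; omega) (hmono (Nat.le_succ i)) le_rfl

/-- The indices that belong to a time form an interval. -/
theorem IsHybridTimeDomain.mem_of_le_of_le (hT : IsHybridTimeDomain T) {t : ℝ} {i l j : ℕ}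
    (hi : (t, i) ∈ T) (hj : (t, j) ∈ T) (hil : i ≤ l) (hlj : l ≤ j) : (t, l) ∈ T := by
  obtain ⟨J, τ, h0, hmono, hE⟩ := hT.2 _ hj
  have hm : ∀ i ≤ j, (t, i) ∈ T → i < J ∧ t ∈ Icc (τ i) (τ (i + 1)) := by
    intro i hij h
    have hm : ((t, i) : ℝ × ℕ) ∈ T ∩ (Icc 0 t ×ˢ Iic j) :=
      ⟨h, ⟨hT.1 _ h, le_rfl⟩, mem_Iic.2 hij⟩
    rw [hE] at hm
    exact hm
  obtain ⟨-, -, h2⟩ := hm i (hil.trans hlj) hi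
  obtain ⟨h3, h4, -⟩ := hm j le_rfl hj
  have : ((t, l) : ℝ × ℕ) ∈ {p : ℝ × ℕ | p.2 < J ∧ p.1 ∈ Icc (τ p.2) (τ (p.2 + 1))} :=
    ⟨hlj.trans_lt h3, (hmono hlj).trans h4, h2.trans (hmono (by simpa using hil))⟩
  rw [← hE] at this
  exact this.1

/-- A function on a hybrid time domain that is continuous on the pieces and does not change at
jumps is a continuous function of the ordinary time. -/
theorem IsHybridTimeDomain.exists_continuousOn {E : Type*} [TopologicalSpace E]
    [Inhabited E] (hT : IsHybridTimeDomain T) (V : ℝ → ℕ → E) (A : Prop)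
    (hA : ¬A → ∀ t, (t, 0) ∈ T → t = 0)
    (hcont : ∀ j s t, s ≤ t → Icc s t ⊆ timeSlice T j → j ≠ 0 ∨ A →
      ContinuousOn (fun t => V t j) (Icc s t))
    (hjump : ∀ t j, (t, j) ∈ T → (t, j + 1) ∈ T → (t, j) ≠ (0, 0) ∨ A → V t j = V t (j + 1)) :
    ∃ U : ℝ → E, ContinuousOn U {t | ∃ j, (t, j) ∈ T} ∧
      ∀ t j, (t, j) ∈ T → (t, j) ≠ (0, 0) ∨ A → V t j = U t := by
  classical
  have hle : ∀ t i d, (t, i) ∈ T → (t, i + d) ∈ T → (t, i) ≠ (0, 0) ∨ A →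
      V t i = V t (i + d) := by
    intro t i d
    induction d with
    | zero => intros; rfl
    | succ d ih =>
      intro h1 h2 h3
      have h4 := hT.mem_of_le_of_le h1 h2 (Nat.le_add_right i d) (by omega)
      rw [ih h1 h4 h3]
      refine hjump t (i + d) h4 h2 (h3.imp_left fun h => ?_)
      simp only [ne_eq, Prod.mk.injEq, not_and] at h ⊢
      intro ht hd
      exact h ht (by omega)
  have heq : ∀ t i j, (t, i) ∈ T → (t, j) ∈ T → (t, i) ≠ (0, 0) ∨ A → (t, j) ≠ (0, 0) ∨ A →
      V t i = V t j := by
    intro t i j h1 h2 h3 h4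
    rcases le_total i j with h | h
    · obtain ⟨d, rfl⟩ := Nat.exists_eq_add_of_le h
      exact hle t i d h1 h2 h3
    · obtain ⟨d, rfl⟩ := Nat.exists_eq_add_of_le h
      exact (hle t j d h2 h1 h4).symm
  -- By `heq` the choice of the index is immaterial; the default value is taken only where no
  -- admissible index exists.
  let U : ℝ → E := fun t =>
    if h : ∃ j, (t, j) ∈ T ∧ ((t, j) ≠ (0, 0) ∨ A) then V t h.choose else default
  have hU : ∀ t j, (t, j) ∈ T → (t, j) ≠ (0, 0) ∨ A → V t j = U t := by
    intro t j h1 h2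
    have h : ∃ j, (t, j) ∈ T ∧ ((t, j) ≠ (0, 0) ∨ A) := ⟨j, h1, h2⟩
    simp only [U, dif_pos h]
    exact heq _ _ _ h1 h.choose_spec.1 h2 h.choose_spec.2
  refine ⟨U, ?_, hU⟩
  have hIcc : ∀ j t, (t, j) ∈ T → ContinuousOn U (Icc 0 t) := by
    have hpiece : ∀ j s t, s ≤ t → Icc s t ⊆ timeSlice T j → j ≠ 0 ∨ A →
        ContinuousOn U (Icc s t) := by
      intro j s t hst hsub hj
      refine (hcont j s t hst hsub hj).congr fun r hr => (hU r j (hsub hr) ?_).symm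
      exact hj.imp_left fun h h' => h (by simpa using congrArg Prod.snd h')
    intro j
    induction j with
    | zero =>
      intro t ht
      by_cases hA' : A
      · obtain ⟨s, hst, hsub, h0, -⟩ := hT.exists_start ht
        rw [h0 rfl] at hst hsub
        exact hpiece 0 0 t hst hsub (Or.inr hA')
      -- In the exceptional case the initial slice is a single time, where continuity is vacuous.
      · rw [hA hA' t ht]
        simp
    | succ i ih =>
      intro t ht
      obtain ⟨s, hst, hsub, -, h1⟩ := hT.exists_start ht
      have hs := h1 i rfl
      rw [← Icc_union_Icc_eq_Icc (hT.1 _ hs) hst]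
      exact (ih s hs).union_of_isClosed
        (hpiece _ s t hst hsub (Or.inl (Nat.succ_ne_zero i))) isClosed_Icc isClosed_Icc
  rintro t ⟨j, hj⟩
  -- If a later time exists, some `Icc 0 t'` is a neighborhood of `t` within the time domain;
  -- otherwise the whole domain lies in `Icc 0 t`.
  by_cases hmax : ∃ t' i, (t', i) ∈ T ∧ t < t'
  · obtain ⟨t', i, hi, hlt⟩ := hmax
    refine (hIcc i t' hi t ⟨hT.1 _ hj, hlt.le⟩).mono_of_mem_nhdsWithin ?_
    filter_upwards [self_mem_nhdsWithin, mem_nhdsWithin_of_mem_nhds (Iio_mem_nhds hlt)]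
      with r hr1 hr2
    obtain ⟨l, hl⟩ := hr1
    exact ⟨hT.1 _ hl, hr2.le⟩
  · push Not at hmax
    refine (hIcc j t hj t ⟨hT.1 _ hj, le_rfl⟩).mono ?_
    rintro r ⟨l, hl⟩
    exact ⟨hT.1 _ hl, hmax r l hl⟩

/-! ### Planar inequalities for cones and Thales circles -/

section Scalars

variable {r η H P b N : ℝ}

/-- Coordinates of a point of a shadow. The vertex is `(r, η)`, the center is the origin, and
`N` is the distance from the vertex. -/
theorem coords_of_shadow (hr : 0 < r) (hη : 0 < η) (hN : N ^ 2 = (P - r) ^ 2 + (b - η) ^ 2)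
    (hN0 : 0 < N) (hcone : η * N ≤ -r * (P - r) - η * (b - η))
    (hthales : 0 ≤ -P * (r - P) - b * (η - b)) (hside : r * b ≤ η * P) : P ≤ r ∧ b ≤ 0 := by
  have hsq : (η * N) ^ 2 ≤ (-r * (P - r) - η * (b - η)) ^ 2 :=
    pow_le_pow_left₀ (by positivity) hcone 2
  have hpos : 0 < η * N := by positivity
  have hP : P ≤ r := by
    by_contra! h
    have ha : 0 < P - r := sub_pos.2 h
    rw [mul_pow, hN] at hsq
    -- The squared cone inequality factors into the equations of the two tangents from the vertex,
    -- one of which is `P = r`.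
    have h1 : 0 ≤ (P - r) * ((P - r) * (r ^ 2 - η ^ 2) - 2 * r * η * (η - b)) := by nlinarith
    have h2 := nonneg_of_mul_nonneg_right h1 ha
    have h3 : r * (P - r) < η * (η - b) := by nlinarith
    nlinarith [mul_lt_mul_of_pos_left h3 hr, mul_pos ha (pow_pos hr 2), mul_pos ha (pow_pos hη 2)]
  refine ⟨hP, ?_⟩
  by_contra! hb
  have hP0 : 0 < P := by
    have : 0 < η * P := (mul_pos hr hb).trans_le hside
    exact pos_of_mul_pos_right this hη.le
  have hbη : b ≤ η := by nlinarith
  have h1 : 0 ≤ P * (r - P) := mul_nonneg hP0.le (sub_nonneg.2 hP)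
  have h2 : 0 ≤ b * (η - b) := mul_nonneg hb.le (sub_nonneg.2 hbη)
  have h3 : P * (r - P) = 0 := by linarith
  have h4 : b * (η - b) = 0 := by linarith
  have h5 : r - P = 0 := (mul_eq_zero.1 h3).resolve_left hP0.ne'
  have h6 : η - b = 0 := (mul_eq_zero.1 h4).resolve_left hb.ne'
  have : N ^ 2 = 0 := by rw [hN]; nlinarith
  exact hN0.ne' (by simpa using this)

/-- The second factor of the squared cone condition is negative: the point lies strictly inside the
other tangent from `(r, η)`. The side condition refers to the axis through `(r, H)`, which is why `η
≤ H` enters; so one half region serves the destination (`η = H`) and the virtual destination (`η =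
h`). -/
theorem cone_gap (hr : 0 < r) (hη : 0 < η) (hηH : η ≤ H) (hP : P ≤ r) (hb : b ≤ 0)
    (hside : r * b ≤ H * P) : (P - r) * (r ^ 2 - η ^ 2) < 2 * r * η * (η - b) := by
  have hH : 0 < H := hη.trans_le hηH
  have h1 : (r - P) * η ≤ r * (η - b) := by
    have : H * ((r - P) * η) ≤ H * (r * (η - b)) := by
      nlinarith [mul_nonneg (mul_nonneg hr.le (neg_nonneg.2 hb)) (sub_nonneg.2 hηH),
        mul_le_mul_of_nonneg_left hside hη.le]
    exact le_of_mul_le_mul_left this hH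
  have h2 : 0 < r * η * (η - b) := by
    have : 0 < η - b := by linarith
    positivity
  nlinarith [mul_le_mul_of_nonneg_left h1 hη.le, mul_nonneg (sub_nonneg.2 hP) (sq_nonneg r)]

theorem cone_of_coords (hr : 0 < r) (hη : 0 < η) (hηH : η ≤ H) (hP : P ≤ r) (hb : b ≤ 0)
    (hside : r * b ≤ H * P) (hN : N ^ 2 = (P - r) ^ 2 + (b - η) ^ 2) :
    η * N ≤ -r * (P - r) - η * (b - η) := by
  have h := cone_gap hr hη hηH hP hb hside
  refine le_of_sq_le_sq ?_ (by nlinarith)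
  rw [mul_pow, hN]
  nlinarith [mul_nonneg (sub_nonneg.2 hP) (sub_nonneg.2 h.le)]

theorem cone_lt_of_coords (hr : 0 < r) (hη : 0 < η) (hηH : η ≤ H) (hP : P < r) (hb : b ≤ 0)
    (hside : r * b ≤ H * P) (hN : N ^ 2 = (P - r) ^ 2 + (b - η) ^ 2) :
    η * N < -r * (P - r) - η * (b - η) := by
  have h := cone_gap hr hη hηH hP.le hb hside
  refine lt_of_pow_lt_pow_left₀ 2 (by nlinarith) ?_
  rw [mul_pow, hN]
  nlinarith [mul_pos (sub_pos.2 hP) (sub_pos.2 h)]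

/-- The right-hand side is `P² + b² - r P - η b`, which is at least `r (r - P) - η b`. -/
theorem thales_of_coords (hη : 0 < η) (hr : 0 < r) (hP : P ≤ r) (hb : b ≤ 0)
    (hout : r ^ 2 ≤ P ^ 2 + b ^ 2) : 0 ≤ -P * (r - P) - b * (η - b) := by
  nlinarith

theorem thales_lt_of_coords (hη : 0 < η) (hr : 0 < r) (hP : P < r) (hb : b ≤ 0)
    (hout : r ^ 2 ≤ P ^ 2 + b ^ 2) : 0 < -P * (r - P) - b * (η - b) := by
  nlinarith

/-- A point beside the axis of the large cone lies strictly beside the axis of the small one. -/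
theorem side_pos (hr : 0 < r) (hη : 0 < η) (hηH : η < H) (hb : b ≤ 0)
    (hside : r * b ≤ H * P) (hout : r ^ 2 ≤ P ^ 2 + b ^ 2) : 0 < η * P - r * b := by
  rcases le_or_gt 0 P with hP | hP
  · rcases hP.eq_or_lt with rfl | hP
    · have : b < 0 := lt_of_le_of_ne hb (by rintro rfl; nlinarith)
      nlinarith
    · nlinarith [mul_pos hη hP]
  · nlinarith [mul_pos (sub_pos.2 hηH) (neg_pos.2 hP)]

end Scalars

/-! ### Distances to an obstacle and the aperture of its enclosing cone -/

namespace Workspace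

variable {n b : ℕ} {W : Workspace n b}

theorem Valid.mem_freeSpace (hW : W.Valid) {q : Pt n} :
    q ∈ W.freeSpace ↔ ∀ k, W.r k ≤ ‖q - W.c k‖ := by
  simp only [freeSpace, obstacle, Set.mem_sdiff, mem_univ, true_and, mem_iUnion, not_exists]
  refine forall_congr' fun k => ?_
  rw [interior_closedBall _ (hW.r_pos k).ne', Metric.mem_ball, dist_eq_norm, not_lt]

theorem isClosed_freeSpace : IsClosed W.freeSpace := by
  rw [freeSpace, ← compl_eq_univ_sdiff]
  exact (isOpen_iUnion fun _ => isOpen_interior).isClosed_compl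

theorem Valid.r_lt_norm_xd_sub (hW : W.Valid) (k : Fin b) : W.r k < ‖W.xd - W.c k‖ := by
  have h1 : W.freeSpace ⊆ (Metric.ball (W.c k) (W.r k))ᶜ := fun q hq => by
    simpa [dist_eq_norm] using hW.mem_freeSpace.1 hq k
  have h2 := interior_mono h1 hW.xd_mem
  rw [interior_compl, closure_ball _ (hW.r_pos k).ne'] at h2
  simpa [dist_eq_norm] using h2

theorem Valid.norm_sub_pos (hW : W.Valid) {q : Pt n} {k : Fin b} (hq : W.r k ≤ ‖q - W.c k‖) :
    0 < ‖q - W.c k‖ := (hW.r_pos k).trans_le hq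

theorem Valid.sin_theta (hW : W.Valid) {q : Pt n} {k : Fin b} (hq : W.r k ≤ ‖q - W.c k‖) :
    Real.sin (W.theta q k) = W.r k / ‖q - W.c k‖ := by
  have h0 := hW.norm_sub_pos hq
  have h1 := hW.r_pos k
  refine Real.sin_arcsin ?_ ?_
  · have : 0 ≤ W.r k / ‖q - W.c k‖ := by positivity
    linarith
  · rwa [div_le_one h0]

theorem Valid.sin_theta_pos (hW : W.Valid) {q : Pt n} {k : Fin b} (hq : W.r k ≤ ‖q - W.c k‖) :
    0 < Real.sin (W.theta q k) := by
  rw [hW.sin_theta hq]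
  exact div_pos (hW.r_pos k) (hW.norm_sub_pos hq)

theorem Valid.theta_pos (hW : W.Valid) {q : Pt n} {k : Fin b} (hq : W.r k ≤ ‖q - W.c k‖) :
    0 < W.theta q k :=
  Real.arcsin_pos.2 (div_pos (hW.r_pos k) (hW.norm_sub_pos hq))

theorem theta_le_pi_div_two (q : Pt n) (k : Fin b) : W.theta q k ≤ Real.pi / 2 :=
  Real.arcsin_le_pi_div_two _

/-- Pythagoras: both sides are the length of the tangent segment from `q` to the obstacle. -/
theorem Valid.norm_mul_cos_theta (hW : W.Valid) {q : Pt n} {k : Fin b}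
    (hq : W.r k ≤ ‖q - W.c k‖) :
    ‖q - W.c k‖ * Real.cos (W.theta q k) = √(‖q - W.c k‖ ^ 2 - W.r k ^ 2) := by
  have h0 := hW.norm_sub_pos hq
  rw [theta, Real.cos_arcsin]
  nth_rewrite 1 [← Real.sqrt_sq h0.le]
  rw [← Real.sqrt_mul (sq_nonneg _)]
  congr 1
  field_simp

theorem Valid.dist_eq (hW : W.Valid) {q : Pt n} {k : Fin b} (hq : W.r k ≤ ‖q - W.c k‖) :
    W.dist q k = ‖q - W.c k‖ - W.r k := by
  have h0 := hW.norm_sub_pos hq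
  have hr := hW.r_pos k
  apply le_antisymm
  · have hmem : W.c k + (W.r k / ‖q - W.c k‖) • (q - W.c k) ∈ W.obstacle k := by
      rw [obstacle, Metric.mem_closedBall, dist_eq_norm, add_sub_cancel_left, norm_smul,
        Real.norm_of_nonneg (by positivity), div_mul_cancel₀ _ h0.ne']
    refine (Metric.infDist_le_dist_of_mem hmem).trans ?_
    have : q - (W.c k + (W.r k / ‖q - W.c k‖) • (q - W.c k)) =
        (1 - W.r k / ‖q - W.c k‖) • (q - W.c k) := by module
    rw [dist_eq_norm, this, norm_smul, Real.norm_of_nonneg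
      (sub_nonneg.2 ((div_le_one h0).2 hq)), sub_mul, div_mul_cancel₀ _ h0.ne', one_mul]
  · refine (Metric.le_infDist ⟨W.c k, Metric.mem_closedBall_self hr.le⟩).2 fun y hy => ?_
    have h1 := Metric.mem_closedBall.1 hy
    have h2 := dist_triangle q y (W.c k)
    rw [← dist_eq_norm]
    linarith

/-! ### Coordinates adapted to a tangent of an obstacle -/

/-- An orthonormal pair such that the center `c k` is the origin, the destination has the
coordinates `(r k, H)` and the virtual destination `z` has the coordinates `(r k, h)`: the common
tangent from `xd` and `z` touches the obstacle at `(r k, 0)`. -/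
structure TangentFrame (W : Workspace n b) (k : Fin b) (z : Pt n) (H h : ℝ) (e₁ e₂ : Pt n) :
    Prop where
  r_pos : 0 < W.r k
  h_pos : 0 < h
  e_pos : 0 < W.e k
  height : H = h + W.e k
  inner₁₁ : inner ℝ e₁ e₁ = (1 : ℝ)
  inner₂₂ : inner ℝ e₂ e₂ = (1 : ℝ)
  inner₁₂ : inner ℝ e₁ e₂ = (0 : ℝ)
  xd_eq : W.xd = W.c k + (W.r k • e₁ + H • e₂)
  z_eq : z = W.c k + (W.r k • e₁ + h • e₂)

namespace TangentFrame

variable {k : Fin b} {z : Pt n} {H h : ℝ} {e₁ e₂ : Pt n}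

theorem h_lt (F : W.TangentFrame k z H h e₁ e₂) : h < H := by
  rw [F.height]; linarith [F.e_pos]

theorem H_pos (F : W.TangentFrame k z H h e₁ e₂) : 0 < H := F.h_pos.trans F.h_lt

theorem inner_comb (F : W.TangentFrame k z H h e₁ e₂) (p q p' q' : ℝ) :
    inner ℝ (p • e₁ + q • e₂) (p' • e₁ + q' • e₂) = p * p' + q * q' := by
  have h21 : inner ℝ e₂ e₁ = (0 : ℝ) := by rw [real_inner_comm, F.inner₁₂]
  simp only [inner_add_left, inner_add_right, real_inner_smul_left, real_inner_smul_right,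
    F.inner₁₁, F.inner₂₂, F.inner₁₂, h21]
  ring

theorem norm_sq_comb (F : W.TangentFrame k z H h e₁ e₂) (p q : ℝ) :
    ‖p • e₁ + q • e₂‖ ^ 2 = p ^ 2 + q ^ 2 := by
  rw [← real_inner_self_eq_norm_sq, F.inner_comb]
  ring

end TangentFrame

end Workspace

/-! ### Virtual destinations, their mirror symmetry and the excluded cones -/

namespace Workspace

variable {n b : ℕ} {W : Workspace n b} {k : Fin b} {z : Pt n} {H h : ℝ} {e₁ e₂ : Pt n}

/-- The metric conditions on a virtual destination, which are invariant under the reflection in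
the axis of the hat. -/
structure IsTangential (W : Workspace n b) (k : Fin b) (y : Pt n) : Prop where
  norm_eq : ‖y - W.xd‖ = W.e k
  inner_eq : inner ℝ (W.c k - W.xd) (y - W.xd) =
    ‖W.c k - W.xd‖ * W.e k * Real.cos (W.theta W.xd k)
  le_inner : W.r k * ‖W.c k - W.xd‖ ≤ ‖W.c k - W.xd‖ ^ 2 - inner ℝ (W.c k - W.xd) (y - W.xd)

theorem IsVirtualDest.isTangential (hW : W.Valid) (hz : W.IsVirtualDest k z) :
    W.IsTangential k z := by
  obtain ⟨⟨⟨⟨-, hcone⟩, -⟩, hhalf⟩, hnorm⟩ := hz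
  have hD := hW.r_lt_norm_xd_sub k
  have hr := hW.r_pos k
  have hD0 : 0 < ‖W.c k - W.xd‖ := by rw [norm_sub_rev]; linarith
  rw [norm_sub_rev] at hD
  rw [norm_sub_rev] at hnorm
  refine ⟨hnorm, by rw [← hcone, hnorm], ?_⟩
  have h1 : W.xd - W.nearPoint k = -(1 - W.r k / ‖W.c k - W.xd‖) • (W.c k - W.xd) := by
    rw [nearPoint, norm_sub_rev W.xd]; module
  have h2 : z - W.nearPoint k =
      (z - W.xd) + (-(1 - W.r k / ‖W.c k - W.xd‖)) • (W.c k - W.xd) := by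
    rw [← h1]; module
  have h3 : 0 ≤ inner ℝ (W.xd - W.nearPoint k) (z - W.nearPoint k) := hhalf
  rw [h2, h1, real_inner_smul_left, inner_add_right, real_inner_smul_right,
    real_inner_self_eq_norm_sq] at h3
  have h4 : 0 < 1 - W.r k / ‖W.c k - W.xd‖ := by rw [sub_pos, div_lt_one hD0]; exact hD
  have h5 := nonneg_of_mul_nonneg_right (by linarith : 0 ≤ (1 - W.r k / ‖W.c k - W.xd‖) *
    (-inner ℝ (W.c k - W.xd) (z - W.xd) +
      (1 - W.r k / ‖W.c k - W.xd‖) * ‖W.c k - W.xd‖ ^ 2)) h4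
  have h6 : (1 - W.r k / ‖W.c k - W.xd‖) * ‖W.c k - W.xd‖ ^ 2 =
      ‖W.c k - W.xd‖ ^ 2 - W.r k * ‖W.c k - W.xd‖ := by field_simp
  linarith

/-- The unit vector from the destination to the center of the obstacle. -/
def axisDir (W : Workspace n b) (k : Fin b) : Pt n := ‖W.c k - W.xd‖⁻¹ • (W.c k - W.xd)

theorem Valid.norm_center_sub_pos (hW : W.Valid) (k : Fin b) : 0 < ‖W.c k - W.xd‖ := by
  rw [norm_sub_rev]
  exact (hW.r_pos k).trans (hW.r_lt_norm_xd_sub k)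

theorem Valid.inner_axisDir_self (hW : W.Valid) (k : Fin b) :
    inner ℝ (W.axisDir k) (W.axisDir k) = (1 : ℝ) := by
  have := hW.norm_center_sub_pos k
  rw [axisDir, real_inner_smul_left, real_inner_smul_right, real_inner_self_eq_norm_sq]
  field_simp

theorem Valid.center_sub_eq (hW : W.Valid) (k : Fin b) :
    W.c k - W.xd = ‖W.c k - W.xd‖ • W.axisDir k := by
  rw [axisDir, smul_inv_smul₀ (hW.norm_center_sub_pos k).ne']

theorem virtualDest_neg_one_sub : W.virtualDest k z (-1) - W.xd =
    (2 * inner ℝ (W.axisDir k) (z - W.xd)) • W.axisDir k - (z - W.xd) := by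
  simp only [virtualDest, reflector, axisDir]
  module

/-- The reflection in the axis is an involution, so the formula that defines `x_k^{-1}` also
recovers `x_k^1`. -/
theorem Valid.virtualDest_neg_sub (hW : W.Valid) {m : SignType} (hm : m ≠ 0) :
    W.virtualDest k z (-m) - W.xd =
      (2 * inner ℝ (W.axisDir k) (W.virtualDest k z m - W.xd)) • W.axisDir k -
        (W.virtualDest k z m - W.xd) := by
  match m, hm with
  | 1, _ => exact virtualDest_neg_one_sub
  | -1, _ =>
    rw [virtualDest_neg_one_sub, inner_sub_right, real_inner_smul_right, hW.inner_axisDir_self]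
    simp only [virtualDest]
    module

theorem IsTangential.virtualDest (hW : W.Valid) (hz : W.IsTangential k z) {m : SignType}
    (hm : m ≠ 0) : W.IsTangential k (W.virtualDest k z m) := by
  match m, hm with
  | 1, _ => exact hz
  | -1, _ =>
    have h1 : inner ℝ (W.axisDir k) (W.virtualDest k z (-1) - W.xd) =
        inner ℝ (W.axisDir k) (z - W.xd) := by
      rw [virtualDest_neg_one_sub, inner_sub_right, real_inner_smul_right, hW.inner_axisDir_self]
      ring
    have h2 : inner ℝ (W.c k - W.xd) (W.virtualDest k z (-1) - W.xd) =
        inner ℝ (W.c k - W.xd) (z - W.xd) := by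
      rw [hW.center_sub_eq, real_inner_smul_left, real_inner_smul_left, h1]
    refine ⟨?_, h2 ▸ hz.inner_eq, h2 ▸ hz.le_inner⟩
    rw [← hz.norm_eq, ← sq_eq_sq₀ (norm_nonneg _) (norm_nonneg _), virtualDest_neg_one_sub,
      norm_sub_sq_real, norm_smul, mul_pow, real_inner_smul_left,
      ← real_inner_self_eq_norm_sq (W.axisDir k), hW.inner_axisDir_self, Real.norm_eq_abs, sq_abs]
    ring

/-- `H` is the length of the tangent segment from the destination, `e₂` points from `z` to the
destination, and `r • e₁` goes from the center to the point of tangency. -/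
theorem IsTangential.exists_tangentFrame (hW : W.Valid) (hz : W.IsTangential k z) :
    ∃ H h e₁ e₂, W.TangentFrame k z H h e₁ e₂ := by
  have hr := hW.r_pos k
  have he := hW.e_pos k
  have hD := hW.r_lt_norm_xd_sub k
  have hH := hW.norm_mul_cos_theta hD.le
  set H := √(‖W.xd - W.c k‖ ^ 2 - W.r k ^ 2) with hHdef
  have hHsq : H ^ 2 = ‖W.xd - W.c k‖ ^ 2 - W.r k ^ 2 := Real.sq_sqrt (by nlinarith)
  rw [norm_sub_rev] at hH hD hHsq
  have hin : inner ℝ (W.c k - W.xd) (z - W.xd) = H * W.e k := by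
    rw [hz.inner_eq, ← hH]; ring
  have hH0 : 0 < H := by
    refine lt_of_le_of_ne (Real.sqrt_nonneg _) fun h0 => ?_
    rw [← h0] at hHsq
    nlinarith
  have hle := hz.le_inner
  rw [hin] at hle
  set w := z - W.xd with hw
  have hww : inner ℝ w w = W.e k ^ 2 := by rw [real_inner_self_eq_norm_sq, hz.norm_eq]
  have hcc : inner ℝ (W.c k - W.xd) (W.c k - W.xd) = H ^ 2 + W.r k ^ 2 := by
    rw [real_inner_self_eq_norm_sq, hHsq]; ring
  have hwc : inner ℝ w (W.c k - W.xd) = H * W.e k := by rw [real_inner_comm, hin]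
  refine ⟨H, H - W.e k, (W.r k)⁻¹ • ((H / W.e k) • w - (W.c k - W.xd)), -((W.e k)⁻¹ • w),
    hr, ?_, he, by ring, ?_, ?_, ?_, ?_, ?_⟩
  -- With `D` the distance from the destination to the center, the half-space condition gives `H e ≤
  -- D² - r D < D² - r² = H²`, so `z` lies before the point of tangency.
  · nlinarith [mul_pos hr (sub_pos.2 hD)]
  · generalize W.c k - W.xd = d at hin hcc hwc ⊢
    simp only [inner_sub_left, inner_sub_right, real_inner_smul_left, real_inner_smul_right,
      hww, hcc, hwc, hin]
    field_simp
    ring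
  · simp only [inner_neg_left, inner_neg_right, real_inner_smul_left, real_inner_smul_right, hww]
    field_simp
  · simp only [inner_neg_right, inner_sub_left, real_inner_smul_left, real_inner_smul_right, hww,
      hin]
    field_simp
    ring
  · rw [smul_inv_smul₀ hr.ne']
    match_scalars <;> field_simp <;> ring
  · rw [smul_inv_smul₀ hr.ne']
    have : z = w + W.xd := by rw [hw]; abel
    rw [this]
    match_scalars <;> field_simp <;> ring

/-- Twice the excess of a virtual destination over the axis is a normal of the axis. -/
theorem TangentFrame.exists_virtualDest_sub (hW : W.Valid) {m : SignType} (hm : m ≠ 0)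
    (F : W.TangentFrame k (W.virtualDest k z m) H h e₁ e₂) :
    ∃ a : ℝ, 0 < a ∧
      W.virtualDest k z m - W.virtualDest k z (-m) = a • (H • e₁ - W.r k • e₂) := by
  have hr := F.r_pos
  have he := F.e_pos
  have hH := F.H_pos
  have hDpos := hW.norm_center_sub_pos k
  have hxc : W.c k - W.xd = (-W.r k) • e₁ + (-H) • e₂ := by rw [F.xd_eq]; module
  have hD : ‖W.c k - W.xd‖ ^ 2 = W.r k ^ 2 + H ^ 2 := by
    rw [hxc, F.norm_sq_comb]; ring
  have hy : W.virtualDest k z m - W.xd = (0 : ℝ) • e₁ + (-W.e k) • e₂ := by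
    rw [F.xd_eq, F.height]
    nth_rewrite 1 [F.z_eq]
    module
  refine ⟨2 * W.e k * W.r k / (W.r k ^ 2 + H ^ 2), by positivity, ?_⟩
  have h1 : W.virtualDest k z m - W.virtualDest k z (-m) =
      (W.virtualDest k z m - W.xd) - (W.virtualDest k z (-m) - W.xd) := by abel
  rw [h1, hW.virtualDest_neg_sub hm, axisDir, real_inner_smul_left, smul_smul, hy, hxc,
    F.inner_comb, ← hxc]
  have h2 : 2 * (‖W.c k - W.xd‖⁻¹ * (-W.r k * 0 + -H * -W.e k)) * ‖W.c k - W.xd‖⁻¹ =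
      2 * (H * W.e k) / (W.r k ^ 2 + H ^ 2) := by
    rw [← hD]; field_simp; ring
  rw [h2, hxc]
  match_scalars <;> field_simp <;> ring

theorem vaxis_neg_eq (hW : W.Valid) {m : SignType} (hm : m ≠ 0) :
    W.vaxis k z (-m) = (2 * inner ℝ (W.axisDir k) (W.vaxis k z m)) • W.axisDir k -
      W.vaxis k z m := by
  have h1 : ∀ m, W.vaxis k z m = (W.c k - W.xd) - (W.virtualDest k z m - W.xd) := fun m => by
    rw [vaxis]; abel
  rw [h1, h1, hW.virtualDest_neg_sub hm, hW.center_sub_eq]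
  generalize W.virtualDest k z m - W.xd = y
  rw [inner_sub_right, real_inner_smul_right, hW.inner_axisDir_self]
  module

/-- The excluded cones are thinner than the angle between their axes and the axis of the hat. -/
theorem IsVirtualDest.inner_axisDir_vaxis_lt (hW : W.Valid) (hz : W.IsVirtualDest k z)
    {m : SignType} (hm : m ≠ 0) : 0 < ‖W.vaxis k z m‖ ∧ 0 < inner ℝ (W.axisDir k) (W.vaxis k z m) ∧
    inner ℝ (W.axisDir k) (W.vaxis k z m) < ‖W.vaxis k z m‖ * Real.cos (W.φ k) := by
  obtain ⟨H, h, e₁, e₂, F⟩ := ((hz.isTangential hW).virtualDest hW hm).exists_tangentFrame hW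
  have hr := F.r_pos
  have hh := F.h_pos
  have hH := F.H_pos
  have hDpos := hW.norm_center_sub_pos k
  have hv : W.vaxis k z m = (-W.r k) • e₁ + (-h) • e₂ := by
    rw [vaxis, F.z_eq]; module
  have hxc : W.c k - W.xd = (-W.r k) • e₁ + (-H) • e₂ := by rw [F.xd_eq]; module
  have hA : 0 < inner ℝ (W.axisDir k) (W.vaxis k z m) := by
    rw [axisDir, real_inner_smul_left, hxc, hv, F.inner_comb, ← hxc]
    have : 0 < -W.r k * -W.r k + -H * -h := by nlinarith [mul_pos hH hh]
    positivity
  have hV : 0 < ‖W.vaxis k z m‖ := by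
    rw [norm_pos_iff]
    intro h0
    rw [h0, inner_zero_right] at hA
    exact hA.false
  refine ⟨hV, hA, ?_⟩
  have hφ : W.φ k <
      InnerProductGeometry.angle (W.vaxis k z m) (W.vaxis k z (-m)) / 2 := by
    have h1 := (lt_min_iff.1 (hW.φ_lt k z hz)).1
    match m, hm with
    | 1, _ => exact h1
    | -1, _ => rwa [InnerProductGeometry.angle_comm, neg_neg]
  set A := inner ℝ (W.axisDir k) (W.vaxis k z m) with hAdef
  set V := ‖W.vaxis k z m‖ with hVdef
  have hnorm : ‖W.vaxis k z (-m)‖ = V := by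
    rw [← sq_eq_sq₀ (norm_nonneg _) (norm_nonneg _), vaxis_neg_eq hW hm, norm_sub_sq_real,
      norm_smul, mul_pow, real_inner_smul_left, ← real_inner_self_eq_norm_sq (W.axisDir k),
      hW.inner_axisDir_self, Real.norm_eq_abs, sq_abs]
    ring
  have hinner : inner ℝ (W.vaxis k z m) (W.vaxis k z (-m)) = 2 * A ^ 2 - V ^ 2 := by
    rw [vaxis_neg_eq hW hm, inner_sub_right, real_inner_smul_right, real_inner_self_eq_norm_sq,
      real_inner_comm (W.axisDir k) (W.vaxis k z m), ← hAdef, ← hVdef]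
    ring
  set ψ := InnerProductGeometry.angle (W.vaxis k z m) (W.vaxis k z (-m)) with hψ
  have hπ : ψ ≤ Real.pi := InnerProductGeometry.angle_le_pi _ _
  have h0 : 0 ≤ ψ := InnerProductGeometry.angle_nonneg _ _
  have hcos : Real.cos ψ = (2 * A ^ 2 - V ^ 2) / (V * V) := by
    rw [hψ, InnerProductGeometry.cos_angle, hinner, hnorm]
  -- The axis of the hat bisects the angle between the two mirror vectors.
  have hhalf : Real.cos (ψ / 2) = A / V := by
    rw [Real.cos_half (by linarith) hπ, hcos]
    have : (1 + (2 * A ^ 2 - V ^ 2) / (V * V)) / 2 = (A / V) ^ 2 := by field_simp; ring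
    rw [this, Real.sqrt_sq (by positivity)]
  have hlt : Real.cos (ψ / 2) < Real.cos (W.φ k) :=
    Real.cos_lt_cos_of_nonneg_of_le_pi (hW.φ_pos k).le (by linarith [Real.pi_pos]) hφ
  rw [hhalf, div_lt_iff₀ hV] at hlt
  linarith

/-- Beside the axis of the hat, on the side of the virtual destination, the excluded cone of the
mode is avoided. -/
theorem IsVirtualDest.inner_vaxis_lt (hW : W.Valid) (hz : W.IsVirtualDest k z)
    {m : SignType} (hm : m ≠ 0) {x : Pt n} (hx : x ≠ W.c k)
    (hside : 0 ≤ inner ℝ (W.virtualDest k z m - W.virtualDest k z (-m)) (x - W.c k)) :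
    inner ℝ (W.vaxis k z m) (x - W.c k) < ‖W.vaxis k z m‖ * ‖x - W.c k‖ * Real.cos (W.φ k) := by
  obtain ⟨-, hA, hlt⟩ := hz.inner_axisDir_vaxis_lt hW hm
  have hx0 : 0 < ‖x - W.c k‖ := norm_pos_iff.2 (sub_ne_zero.2 hx)
  have h1 : W.virtualDest k z m - W.virtualDest k z (-m) =
      W.vaxis k z (-m) - W.vaxis k z m := by simp only [vaxis]; abel
  rw [h1, vaxis_neg_eq hW hm, inner_sub_left, inner_sub_left, real_inner_smul_left] at hside
  have h2 : inner ℝ (W.axisDir k) (x - W.c k) ≤ ‖x - W.c k‖ := by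
    have h3 : ‖W.axisDir k‖ = 1 := by
      rw [← sq_eq_sq₀ (norm_nonneg _) zero_le_one, ← real_inner_self_eq_norm_sq,
        hW.inner_axisDir_self, one_pow]
    simpa [h3] using real_inner_le_norm (W.axisDir k) (x - W.c k)
  have h4 := mul_le_mul_of_nonneg_left h2 hA.le
  have h5 := mul_lt_mul_of_pos_right hlt hx0
  nlinarith

/-- The mode-switching map selects the side of the position. -/
theorem IsVirtualDest.of_mem_Bhat (hW : W.Valid) (hz : W.IsVirtualDest k z) {x : Pt n}
    (hx : x ≠ W.c k) {m : SignType} (hm : m ∈ W.Bhat x k z) : m ≠ 0 ∧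
    0 ≤ inner ℝ (W.virtualDest k z m - W.virtualDest k z (-m)) (x - W.c k) := by
  -- On the wrong side of the axis, `x` would be on the side of the opposite virtual destination,
  -- hence in its outer cone.
  have key : ∀ m : SignType, m ≠ 0 → x ∉ W.outerCone k z (-m) →
      0 ≤ inner ℝ (W.virtualDest k z m - W.virtualDest k z (-m)) (x - W.c k) := by
    intro m hm hout
    by_contra! hneg
    refine hout ⟨mem_univ _, (hz.inner_vaxis_lt hW (m := -m) (by simpa using hm) hx ?_).le⟩
    rw [neg_neg, ← neg_sub, inner_neg_left]
    linarith
  have h1 : W.virtualDest k z 1 - W.virtualDest k z (-1) =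
    -(W.virtualDest k z (-1) - W.virtualDest k z 1) := by abel
  simp only [Bhat, mem_ofPred_eq, mem_union, mem_inter_iff, Set.mem_sdiff, halfSpaceLT, halfSpaceGT,
    hyperplane] at hm
  rcases hm with ⟨rfl, hm | hm⟩ | ⟨rfl, hm | hm⟩ | ⟨rfl | rfl, hm⟩
  · exact ⟨by decide, key 1 (by decide) hm.2⟩
  · exact ⟨by decide, by rw [h1, inner_neg_left]; linarith [hm.2]⟩
  · exact ⟨by decide, key (-1) (by decide) (by simpa using hm.2)⟩
  · exact ⟨by decide, by rw [neg_neg]; exact hm.2.le⟩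
  · exact ⟨by decide, by rw [h1, inner_neg_left]; linarith [hm.2]⟩
  · exact ⟨by decide, by rw [neg_neg]; exact hm.2.ge⟩

end Workspace

/-! ### The half region of a maneuver and its boundary -/

namespace Workspace

variable {n b : ℕ} {W : Workspace n b} {k : Fin b} {z x y : Pt n} {H h η P q : ℝ} {e₁ e₂ : Pt n}

/-- The set in which an avoidance maneuver takes place: the half of the active region, in the plane
of the tangent frame, on the side of the virtual destination. The coordinates of `x` are `P`, `q`. -/
structure InHalfRegion (W : Workspace n b) (k : Fin b) (H : ℝ) (e₁ e₂ x : Pt n) (P q : ℝ) :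
    Prop where
  pos_eq : x = W.c k + (P • e₁ + q • e₂)
  le_r : P ≤ W.r k
  nonpos : q ≤ 0
  side : W.r k * q ≤ H * P
  free : x ∈ W.freeSpace
  near : ‖x - W.c k‖ ≤ W.r k + W.rbar k

theorem InHalfRegion.r_le_norm_sub (hW : W.Valid) (hR : W.InHalfRegion k H e₁ e₂ x P q) :
    W.r k ≤ ‖x - W.c k‖ := hW.mem_freeSpace.1 hR.free k

theorem InHalfRegion.ne_center (hW : W.Valid) (hR : W.InHalfRegion k H e₁ e₂ x P q) :
    x ≠ W.c k :=
  sub_ne_zero.1 (norm_pos_iff.1 (hW.norm_sub_pos (hR.r_le_norm_sub hW)))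

namespace TangentFrame

theorem inner_center_sub (F : W.TangentFrame k z H h e₁ e₂) (hx : x = W.c k + (P • e₁ + q • e₂))
    (hy : y = W.c k + (W.r k • e₁ + η • e₂)) :
    inner ℝ (W.c k - y) (x - y) = -W.r k * (P - W.r k) - η * (q - η) := by
  have h1 : W.c k - y = (-W.r k) • e₁ + (-η) • e₂ := by rw [hy]; module
  have h2 : x - y = (P - W.r k) • e₁ + (q - η) • e₂ := by rw [hx, hy]; module
  rw [h1, h2, F.inner_comb]; ring

theorem inner_sub_sub (F : W.TangentFrame k z H h e₁ e₂) (hx : x = W.c k + (P • e₁ + q • e₂))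
    (hy : y = W.c k + (W.r k • e₁ + η • e₂)) :
    inner ℝ (W.c k - x) (y - x) = -P * (W.r k - P) - q * (η - q) := by
  have h1 : W.c k - x = (-P) • e₁ + (-q) • e₂ := by rw [hx]; module
  have h2 : y - x = (W.r k - P) • e₁ + (η - q) • e₂ := by rw [hx, hy]; module
  rw [h1, h2, F.inner_comb]; ring

theorem norm_sub_sq (F : W.TangentFrame k z H h e₁ e₂) (hx : x = W.c k + (P • e₁ + q • e₂))
    (hy : y = W.c k + (W.r k • e₁ + η • e₂)) :
    ‖x - y‖ ^ 2 = (P - W.r k) ^ 2 + (q - η) ^ 2 := by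
  have h2 : x - y = (P - W.r k) • e₁ + (q - η) • e₂ := by rw [hx, hy]; module
  rw [h2, F.norm_sq_comb]

theorem norm_sub_center_sq (F : W.TangentFrame k z H h e₁ e₂)
    (hx : x = W.c k + (P • e₁ + q • e₂)) : ‖x - W.c k‖ ^ 2 = P ^ 2 + q ^ 2 := by
  rw [hx, add_sub_cancel_left, F.norm_sq_comb]

theorem norm_vertex_sq (F : W.TangentFrame k z H h e₁ e₂)
    (hy : y = W.c k + (W.r k • e₁ + η • e₂)) : ‖y - W.c k‖ ^ 2 = W.r k ^ 2 + η ^ 2 :=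
  F.norm_sub_center_sq hy

theorem r_le_norm_vertex (F : W.TangentFrame k z H h e₁ e₂)
    (hy : y = W.c k + (W.r k • e₁ + η • e₂)) : W.r k ≤ ‖y - W.c k‖ := by
  refine le_of_sq_le_sq ?_ (norm_nonneg _)
  rw [F.norm_vertex_sq hy]
  nlinarith [sq_nonneg η]

theorem norm_mul_cos (hW : W.Valid) (F : W.TangentFrame k z H h e₁ e₂) (hη : 0 < η)
    (hy : y = W.c k + (W.r k • e₁ + η • e₂)) :
    ‖W.c k - y‖ * Real.cos (W.theta y k) = η := by
  rw [norm_sub_rev, hW.norm_mul_cos_theta (F.r_le_norm_vertex hy), F.norm_vertex_sq hy,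
    add_sub_cancel_left, Real.sqrt_sq hη.le]

/-- The points hidden from a point of the tangent, on its side. -/
theorem inHalfRegion_of_mem_active (hW : W.Valid) (F : W.TangentFrame k z H h e₁ e₂)
    (hη : 0 < η) (hy : y = W.c k + (W.r k • e₁ + η • e₂)) (hx : x = W.c k + (P • e₁ + q • e₂))
    (hside : W.r k * q ≤ H * P) (hside' : W.r k * q ≤ η * P) (hact : x ∈ W.active k y) :
    W.InHalfRegion k H e₁ e₂ x P q := by
  obtain ⟨⟨⟨hfree, hcone⟩, hthales, hne⟩, hball⟩ := hact
  rw [mul_right_comm, F.norm_mul_cos hW hη hy, F.inner_center_sub hx hy] at hcone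
  rw [F.inner_sub_sub hx hy] at hthales
  obtain ⟨h1, h2⟩ := coords_of_shadow F.r_pos hη (F.norm_sub_sq hx hy)
    (norm_pos_iff.2 (sub_ne_zero.2 hne)) hcone hthales hside'
  exact ⟨hx, h1, h2, hside, hfree, by simpa [dist_eq_norm] using hball⟩

variable (hW : W.Valid) (F : W.TangentFrame k z H h e₁ e₂) (hR : W.InHalfRegion k H e₁ e₂ x P q)
include hW F hR

theorem out_sq : W.r k ^ 2 ≤ P ^ 2 + q ^ 2 := by
  rw [← F.norm_sub_center_sq hR.pos_eq]
  exact pow_le_pow_left₀ F.r_pos.le (hW.mem_freeSpace.1 hR.free k) 2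

omit hW in
theorem norm_sub_vertex_pos (hη : 0 < η) (hy : y = W.c k + (W.r k • e₁ + η • e₂)) :
    0 < ‖x - y‖ := by
  have h1 := F.norm_sub_sq hR.pos_eq hy
  have h2 := hR.nonpos
  have h3 : 0 < ‖x - y‖ ^ 2 := by rw [h1]; nlinarith [sq_nonneg (P - W.r k)]
  exact lt_of_pow_lt_pow_left₀ 2 (norm_nonneg _) (by simpa using h3)

theorem mem_active (hη : 0 < η) (hηH : η ≤ H) (hy : y = W.c k + (W.r k • e₁ + η • e₂)) :
    x ∈ W.active k y := by
  refine ⟨⟨⟨hR.free, ?_⟩, ?_, ?_⟩, by simpa [dist_eq_norm] using hR.near⟩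
  · rw [mul_right_comm, F.norm_mul_cos hW hη hy, F.inner_center_sub hR.pos_eq hy]
    exact cone_of_coords F.r_pos hη hηH hR.le_r hR.nonpos hR.side (F.norm_sub_sq hR.pos_eq hy)
  · rw [F.inner_sub_sub hR.pos_eq hy]
    exact thales_of_coords hη F.r_pos hR.le_r hR.nonpos (out_sq hW F hR)
  · exact sub_ne_zero.1 (norm_pos_iff.1 (norm_sub_vertex_pos F hR hη hy))

/-- Away from the tangent and the outer sphere, the inequalities that define the active region are
strict, hence persist nearby. -/
theorem eventually_mem_active (hη : 0 < η) (hηH : η ≤ H)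
    (hy : y = W.c k + (W.r k • e₁ + η • e₂)) (hP : P < W.r k)
    (hnear : ‖x - W.c k‖ < W.r k + W.rbar k) :
    ∀ᶠ x' in 𝓝 x, x' ∈ W.freeSpace → x' ∈ W.active k y := by
  have h1 : ‖W.c k - y‖ * ‖x - y‖ * Real.cos (W.theta y k) < inner ℝ (W.c k - y) (x - y) := by
    rw [mul_right_comm, F.norm_mul_cos hW hη hy, F.inner_center_sub hR.pos_eq hy]
    exact cone_lt_of_coords F.r_pos hη hηH hP hR.nonpos hR.side (F.norm_sub_sq hR.pos_eq hy)
  have h2 : 0 < inner ℝ (W.c k - x) (y - x) := by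
    rw [F.inner_sub_sub hR.pos_eq hy]
    exact thales_lt_of_coords hη F.r_pos hP hR.nonpos (out_sq hW F hR)
  have h3 : x ≠ y := sub_ne_zero.1 (norm_pos_iff.1 (norm_sub_vertex_pos F hR hη hy))
  have c1 : ContinuousAt (fun x => ‖W.c k - y‖ * ‖x - y‖ * Real.cos (W.theta y k)) x := by
    fun_prop
  have c2 : ContinuousAt (fun x => inner ℝ (W.c k - y) (x - y)) x := by fun_prop
  have c3 : ContinuousAt (fun x => inner ℝ (W.c k - x) (y - x)) x := by fun_prop
  have c4 : ContinuousAt (fun x => ‖x - W.c k‖) x := by fun_prop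
  filter_upwards [c1.eventually_lt c2 h1, continuousAt_const.eventually_lt c3 h2,
    isOpen_ne.mem_nhds h3, c4.eventually_lt continuousAt_const hnear] with x' g1 g2 g3 g4 g5
  exact ⟨⟨⟨g5, g1.le⟩, g2.le, g3⟩, by simpa [dist_eq_norm] using g4.le⟩

theorem eq_r_of_cone_eq
    (hcone : ‖W.c k - W.xd‖ * ‖x - W.xd‖ * Real.cos (W.theta W.xd k) =
      inner ℝ (W.c k - W.xd) (x - W.xd)) : P = W.r k := by
  refine hR.le_r.antisymm (not_lt.1 fun hP => ?_)
  rw [mul_right_comm, F.norm_mul_cos hW F.H_pos F.xd_eq,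
    F.inner_center_sub hR.pos_eq F.xd_eq] at hcone
  exact (cone_lt_of_coords F.r_pos F.H_pos le_rfl hP hR.nonpos hR.side
    (F.norm_sub_sq hR.pos_eq F.xd_eq)).ne hcone

theorem cone_eq_of_eq_r (hP : P = W.r k) :
    ‖W.c k - W.xd‖ * ‖x - W.xd‖ * Real.cos (W.theta W.xd k) =
      inner ℝ (W.c k - W.xd) (x - W.xd) := by
  have h1 := F.norm_sub_sq hR.pos_eq F.xd_eq
  have h2 : ‖x - W.xd‖ = H - q := by
    rw [← sq_eq_sq₀ (norm_nonneg _) (by linarith [F.H_pos, hR.nonpos]), h1, hP]; ring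
  rw [mul_right_comm, F.norm_mul_cos hW F.H_pos F.xd_eq,
    F.inner_center_sub hR.pos_eq F.xd_eq, h2, hP]
  ring

omit hW in
theorem inner_normal : inner ℝ (H • e₁ - W.r k • e₂) (x - W.c k) = H * P - W.r k * q := by
  have h1 : H • e₁ - W.r k • e₂ = H • e₁ + (-W.r k) • e₂ := by module
  rw [h1, hR.pos_eq, add_sub_cancel_left, F.inner_comb]; ring

end TangentFrame

/-- The invariant of an avoidance maneuver. -/
structure Maneuver (W : Workspace n b) (k : Fin b) (z : Pt n) (m : SignType) (H h : ℝ)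
    (e₁ e₂ x : Pt n) (P q : ℝ) : Prop where
  mode_ne : m ≠ 0
  dest : W.IsVirtualDest k z
  frame : W.TangentFrame k (W.virtualDest k z m) H h e₁ e₂
  region : W.InHalfRegion k H e₁ e₂ x P q

namespace Maneuver

variable {m : SignType} (hW : W.Valid) (M : W.Maneuver k z m H h e₁ e₂ x P q)
include hW M

theorem inner_vaxis_lt : inner ℝ (W.vaxis k z m) (x - W.c k) <
    ‖W.vaxis k z m‖ * ‖x - W.c k‖ * Real.cos (W.φ k) := by
  obtain ⟨a, ha, hd⟩ := M.frame.exists_virtualDest_sub hW M.mode_ne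
  refine M.dest.inner_vaxis_lt hW M.mode_ne (M.region.ne_center hW) ?_
  rw [hd, real_inner_smul_left, M.frame.inner_normal M.region]
  exact mul_nonneg ha.le (sub_nonneg.2 M.region.side)

theorem mem_flowAvoid : x ∈ W.flowAvoid k z m :=
  ⟨M.frame.mem_active hW M.region M.frame.h_pos M.frame.h_lt.le M.frame.z_eq,
    fun h => (M.inner_vaxis_lt hW).not_gt h.2⟩

theorem mem_active_xd : x ∈ W.active k W.xd :=
  M.frame.mem_active hW M.region M.frame.H_pos le_rfl M.frame.xd_eq

/-- Off these two boundary pieces all nearby free points belong to the flow set of the mode, so `x`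
is not in the closure of its complement. The excluded cone plays no role, since it stays strictly
away from the half region. -/
theorem boundary_of_mem_jumpAvoid (hx : x ∈ W.jumpAvoid k z m) :
    P = W.r k ∨ ‖x - W.c k‖ = W.r k + W.rbar k := by
  by_contra! hcon
  have hP := lt_of_le_of_ne M.region.le_r hcon.1
  have hnear := lt_of_le_of_ne M.region.near hcon.2
  have h1 := M.frame.eventually_mem_active hW M.region M.frame.h_pos M.frame.h_lt.le M.frame.z_eq
    hP hnear
  have c1 : ContinuousAt (fun x => inner ℝ (W.vaxis k z m) (x - W.c k)) x := by fun_prop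
  have c2 : ContinuousAt (fun x => ‖W.vaxis k z m‖ * ‖x - W.c k‖ * Real.cos (W.φ k)) x := by
    fun_prop
  have h2 := c1.eventually_lt c2 (M.inner_vaxis_lt hW)
  obtain ⟨x', ⟨hf, hnot⟩, h3, h4⟩ := ((mem_closure_iff_frequently.1 hx).and_eventually
    (h1.and h2)).exists
  exact hnot ⟨h3 hf, fun h => h4.not_gt h.2⟩

theorem boundary_of_mem_flowDest (hx : x ∈ W.flowDest) :
    P = W.r k ∨ ‖x - W.c k‖ = W.r k + W.rbar k := by
  by_contra! hcon
  have hP := lt_of_le_of_ne M.region.le_r hcon.1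
  have hnear := lt_of_le_of_ne M.region.near hcon.2
  have h1 := M.frame.eventually_mem_active hW M.region M.frame.H_pos le_rfl M.frame.xd_eq
    hP hnear
  obtain ⟨x', ⟨hf, hnot⟩, h3⟩ := ((mem_closure_iff_frequently.1
    (mem_iInter.1 hx k)).and_eventually h1).exists
  exact hnot (h3 hf)

end Maneuver

theorem exists_of_mem_planeThrough {q₁ q₂ y v : Pt n} (hv : v ∈ planeThrough q₁ q₂ y) :
    ∃ α ν : ℝ, v - q₁ = α • (q₂ - q₁) + ν • (y - q₁) := by
  have h1 : q₁ ∈ ({q₁, q₂, y} : Set (Pt n)) := mem_insert _ _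
  have h2 := AffineSubspace.vsub_mem_direction hv (subset_affineSpan ℝ _ h1)
  rw [direction_affineSpan, vectorSpan_eq_span_vsub_set_right ℝ h1, image_insert_eq, image_pair,
    vsub_self, Submodule.span_insert_zero] at h2
  obtain ⟨α, ν, h⟩ := Submodule.mem_span_pair.1 h2
  exact ⟨α, ν, h.symm⟩

/-- A jump from the motion-to-destination mode starts a maneuver. -/
theorem exists_maneuver (hW : W.Valid) {m : SignType} (hx : x ∈ W.active k W.xd)
    (hz : W.IsPlanarVirtualDest k x z) (hm : m ∈ W.Bhat x k z) :
    ∃ H h e₁ e₂ P q, W.Maneuver k z m H h e₁ e₂ x P q := by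
  obtain ⟨hvd, y, hyl, hxy, hplane⟩ := hz
  have hxc : x ≠ W.c k := sub_ne_zero.1 (norm_pos_iff.1
    (hW.norm_sub_pos (hW.mem_freeSpace.1 hx.1.1.1 k)))
  obtain ⟨hm0, hside⟩ := hvd.of_mem_Bhat hW hxc hm
  obtain ⟨H, h, e₁, e₂, F⟩ := ((hvd.isTangential hW).virtualDest hW hm0).exists_tangentFrame hW
  have hr := F.r_pos
  have hH := F.H_pos
  have he := F.e_pos
  have hplanar : ∃ P q : ℝ, x = W.c k + (P • e₁ + q • e₂) := by
    -- A position on the axis lies in every plane that contains the axis. Otherwise the planarity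
    -- condition is solved for the position.
    by_cases hxl : x ∈ lineThrough W.xd (W.c k)
    · obtain ⟨t, ht⟩ := hxl
      refine ⟨(1 - t) * W.r k, (1 - t) * H, ?_⟩
      rw [ht, F.xd_eq]; module
    · have hp := hplane m hm0
      rw [hxy hxl] at hp
      obtain ⟨α, ν, hαν⟩ := exists_of_mem_planeThrough hp
      have hz : W.virtualDest k z m - W.xd = (0 : ℝ) • e₁ + (-W.e k) • e₂ := by
        rw [F.xd_eq, F.height]
        nth_rewrite 1 [F.z_eq]
        module
      -- Otherwise the virtual destination would be on the axis, which the tangent meets only at the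
      -- destination, whereas `e > 0`.
      have hν : ν ≠ 0 := by
        rintro rfl
        have hcx : W.c k - W.xd = (-W.r k) • e₁ + (-H) • e₂ := by rw [F.xd_eq]; module
        rw [hz, zero_smul ℝ (x - W.xd), add_zero, hcx] at hαν
        have h1 := congrArg (fun v => inner ℝ v ((1 : ℝ) • e₁ + (0 : ℝ) • e₂)) hαν
        have h2 := congrArg (fun v => inner ℝ v ((0 : ℝ) • e₁ + (1 : ℝ) • e₂)) hαν
        simp only [real_inner_smul_left, F.inner_comb] at h1 h2
        have h3 : α = 0 := by
          have : α * W.r k = 0 := by linarith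
          exact (mul_eq_zero.1 this).resolve_right hr.ne'
        rw [h3] at h2
        linarith
      have hx' : x = W.xd + ν⁻¹ • ((W.virtualDest k z m - W.xd) - α • (W.c k - W.xd)) := by
        rw [hαν, add_sub_cancel_left, inv_smul_smul₀ hν]; abel
      refine ⟨W.r k + ν⁻¹ * (α * W.r k), H + ν⁻¹ * (-W.e k + α * H), ?_⟩
      rw [hx', hz, F.xd_eq]
      module
  obtain ⟨P, q, hPq⟩ := hplanar
  obtain ⟨a, ha, hd⟩ := F.exists_virtualDest_sub hW hm0
  have hs : W.r k * q ≤ H * P := by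
    have h1 : H • e₁ - W.r k • e₂ = H • e₁ + (-W.r k) • e₂ := by module
    rw [hd, real_inner_smul_left, h1, hPq, add_sub_cancel_left, F.inner_comb] at hside
    have := nonneg_of_mul_nonneg_right hside ha
    linarith
  exact ⟨H, h, e₁, e₂, P, q, hm0, hvd, F,
    F.inHalfRegion_of_mem_active hW hH F.xd_eq hPq hs hs hx⟩

end Workspace

/-! ### The avoidance control: tangency, optimality, regularity -/

namespace Workspace

variable {n b : ℕ} {W : Workspace n b} {k : Fin b} {z x : Pt n} {H h P q : ℝ} {e₁ e₂ : Pt n}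
  {m : SignType}

theorem beta_eq (hW : W.Valid) : W.beta x k z m =
    InnerProductGeometry.angle (W.c k - x) (W.virtualDest k z m - x) := by
  rw [beta, kappaBar, InnerProductGeometry.angle_smul_right_of_pos _ _ hW.γ_pos]

theorem norm_kappaBar (hW : W.Valid) :
    ‖W.kappaBar x k z m‖ = W.γ * ‖W.virtualDest k z m - x‖ := by
  rw [kappaBar, norm_smul, Real.norm_of_nonneg hW.γ_pos.le]

/-- The inner product of the nominal control with the direction to the center. -/
theorem inner_kappaBar :
    inner ℝ (W.kappaBar x k z m) (W.c k - x) =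
      ‖W.kappaBar x k z m‖ * ‖W.c k - x‖ * Real.cos (W.beta x k z m) := by
  rw [beta, real_inner_comm, mul_comm _ (Real.cos _), mul_comm ‖W.kappaBar x k z m‖,
    InnerProductGeometry.cos_angle_mul_norm_mul_norm]

theorem tau_eq (hW : W.Valid) (hx : W.r k ≤ ‖x - W.c k‖) :
    W.tau x k z m = ‖W.kappaBar x k z m‖ * (Real.cos (W.beta x k z m) -
      Real.cos (W.theta x k) * Real.sin (W.beta x k z m) / Real.sin (W.theta x k)) := by
  have hs := hW.sin_theta_pos hx
  rw [tau, Real.sin_sub]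
  field_simp

/-- This is the law of sines in the triangle with sides `κ`, `κ̄` and `τ` times the unit vector
towards the center. -/
theorem norm_kappa (hW : W.Valid) (hx : W.r k ≤ ‖x - W.c k‖) :
    ‖W.kappa x k z m‖ =
      ‖W.kappaBar x k z m‖ * Real.sin (W.beta x k z m) / Real.sin (W.theta x k) := by
  have hs := hW.sin_theta_pos hx
  have hd : 0 < ‖W.c k - x‖ := by rw [norm_sub_rev]; exact hW.norm_sub_pos hx
  have hβ : 0 ≤ Real.sin (W.beta x k z m) := InnerProductGeometry.sin_angle_nonneg _ _
  rw [← sq_eq_sq₀ (norm_nonneg _) (by positivity), kappa, smul_smul, norm_sub_sq_real, norm_smul,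
    real_inner_smul_right, inner_kappaBar, mul_pow, Real.norm_eq_abs, sq_abs,
    tau_eq hW hx]
  have h1 := Real.sin_sq_add_cos_sq (W.theta x k)
  have h2 := Real.sin_sq_add_cos_sq (W.beta x k z m)
  field_simp
  generalize Real.sin (W.theta x k) = s at *
  generalize Real.cos (W.theta x k) = c at *
  generalize Real.sin (W.beta x k z m) = s' at *
  generalize Real.cos (W.beta x k z m) = c' at *
  linear_combination ‖W.kappaBar x k z m‖ ^ 2 * (s' ^ 2 * h1 - s ^ 2 * h2)

theorem inner_kappa (hW : W.Valid) (hx : W.r k ≤ ‖x - W.c k‖) :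
    inner ℝ (W.kappa x k z m) (W.c k - x) =
      ‖W.kappa x k z m‖ * ‖W.c k - x‖ * Real.cos (W.theta x k) := by
  have hs := hW.sin_theta_pos hx
  have hd : 0 < ‖W.c k - x‖ := by rw [norm_sub_rev]; exact hW.norm_sub_pos hx
  rw [norm_kappa hW hx, kappa, smul_smul, inner_sub_left, real_inner_smul_left, inner_kappaBar,
    real_inner_self_eq_norm_sq, tau_eq hW hx]
  field_simp
  ring

/-- Eliminating the virtual destination writes `xd - x` as `A • κ + B • (c - x)` with `A ≥ 0`. The
second term has the same inner product with every unit tangent vector, and the first is largest at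
`κ` by Cauchy–Schwarz. -/
theorem isLocallyOptimal_kappa (hW : W.Valid) (hx : W.r k ≤ ‖x - W.c k‖)
    (hβ : 0 < Real.sin (W.beta x k z m)) (hz : x ≠ W.virtualDest k z m) {t s : ℝ} (ht : 0 ≤ t)
    (hxd : W.xd - x = t • (W.virtualDest k z m - x) + s • (W.c k - x)) :
    W.IsLocallyOptimal x k (W.kappa x k z m) := by
  have hs := hW.sin_theta_pos hx
  have hγ := hW.γ_pos
  have hd : 0 < ‖W.c k - x‖ := by rw [norm_sub_rev]; exact hW.norm_sub_pos hx
  have hκ : 0 < ‖W.kappa x k z m‖ := by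
    have : 0 < ‖W.virtualDest k z m - x‖ := norm_pos_iff.2 (sub_ne_zero.2 hz.symm)
    rw [norm_kappa hW hx, norm_kappaBar hW]
    positivity
  refine ⟨norm_pos_iff.1 hκ, inner_kappa hW hx, fun v hv hv0 => ?_⟩
  have hv' : inner ℝ v (W.c k - x) = ‖v‖ * ‖W.c k - x‖ * Real.cos (W.theta x k) := hv
  have hvpos : 0 < ‖v‖ := norm_pos_iff.2 hv0
  have hw : W.virtualDest k z m - x = W.γ⁻¹ • W.kappa x k z m +
      (W.γ⁻¹ * (W.tau x k z m * ‖W.c k - x‖⁻¹)) • (W.c k - x) := by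
    rw [kappa, kappaBar]
    match_scalars <;> field_simp <;> ring
  have hX : W.xd - x = (t * W.γ⁻¹) • W.kappa x k z m +
      (t * (W.γ⁻¹ * (W.tau x k z m * ‖W.c k - x‖⁻¹)) + s) • (W.c k - x) := by
    rw [hxd, hw]; module
  set A := t * W.γ⁻¹ with hA
  set B := t * (W.γ⁻¹ * (W.tau x k z m * ‖W.c k - x‖⁻¹)) + s
  have hA0 : 0 ≤ A := by positivity
  have hmain : inner ℝ (W.xd - x) v / ‖v‖ ≤
      inner ℝ (W.xd - x) (W.kappa x k z m) / ‖W.kappa x k z m‖ := by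
    rw [hX, inner_add_left, inner_add_left, real_inner_smul_left, real_inner_smul_left,
      real_inner_smul_left, real_inner_smul_left, real_inner_comm v, real_inner_comm v (W.c k - x),
      real_inner_comm (W.kappa x k z m) (W.c k - x),
      inner_kappa hW hx, real_inner_self_eq_norm_sq, hv',
      div_le_div_iff₀ hvpos hκ]
    have hcs := mul_le_mul_of_nonneg_left (real_inner_le_norm v (W.kappa x k z m)) hA0
    nlinarith [mul_le_mul_of_nonneg_right hcs hκ.le]
  rw [InnerProductGeometry.angle, InnerProductGeometry.angle]
  refine Real.arccos_le_arccos ?_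
  rw [mul_comm, ← div_div, mul_comm, ← div_div]
  -- Nonnegativity of `‖xd - x‖` suffices: if it vanishes, both quotients are zero.
  exact div_le_div_of_nonneg_right hmain (norm_nonneg _)

theorem IsLocallyOptimal.smul {w : Pt n} (hw : W.IsLocallyOptimal x k w) {a : ℝ} (ha : 0 < a) :
    W.IsLocallyOptimal x k (a • w) := by
  obtain ⟨h1, h2, h3⟩ := hw
  have h2' : inner ℝ w (W.c k - x) = ‖w‖ * ‖W.c k - x‖ * Real.cos (W.theta x k) := h2
  refine ⟨smul_ne_zero ha.ne' h1, ?_, fun v hv hv0 => ?_⟩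
  · change inner ℝ (a • w) (W.c k - x) = _
    rw [real_inner_smul_left, h2', norm_smul, Real.norm_of_nonneg ha.le]
    ring
  · rw [InnerProductGeometry.angle_smul_right_of_pos _ _ ha]
    exact h3 v hv hv0

theorem one_le_mu (hW : W.Valid) (hx : W.r k ≤ ‖x - W.c k‖) : 1 ≤ W.mu x k z m := by
  have h1 := hW.e_pos k
  have h2 := hW.theta_pos hx
  have h3 : 0 ≤ W.beta x k z m := InnerProductGeometry.angle_nonneg _ _
  have : 0 ≤ W.e k / ‖x - W.virtualDest k z m‖ * (W.beta x k z m / W.theta x k) := by positivity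
  rw [mu]
  linarith

/-- In this clamped form continuity is immediate. -/
theorem alpha_eq (hW : W.Valid) (x : Pt n) (k : Fin b) :
    W.alpha x k = max 0 (min 1 ((W.rbar k - W.dist x k) / W.ε)) := by
  have hε := hW.ε_pos
  rw [alpha]
  split_ifs with h1 h2
  · have : 1 ≤ (W.rbar k - W.dist x k) / W.ε := by rw [one_le_div hε]; linarith
    rw [min_eq_left this, max_eq_right zero_le_one]
  · have h3 : (W.rbar k - W.dist x k) / W.ε ≤ 1 := by rw [div_le_one hε]; linarith
    have h4 : 0 ≤ (W.rbar k - W.dist x k) / W.ε := div_nonneg (by linarith) hε.le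
    rw [min_eq_right h3, max_eq_right h4]
  · have h3 : (W.rbar k - W.dist x k) / W.ε ≤ 0 :=
      div_nonpos_of_nonpos_of_nonneg (by linarith) hε.le
    rw [min_eq_right (h3.trans zero_le_one), max_eq_left h3]

theorem alpha_eq_one (hW : W.Valid) (hx : W.dist x k ≤ W.rbar k - W.ε) : W.alpha x k = 1 := by
  have : 1 ≤ (W.rbar k - W.dist x k) / W.ε := by rw [one_le_div hW.ε_pos]; linarith
  rw [alpha_eq hW, min_eq_left this, max_eq_right zero_le_one]

theorem continuous_alpha (hW : W.Valid) (k : Fin b) : Continuous fun x => W.alpha x k := by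
  simp only [alpha_eq hW, dist]
  have := Metric.continuous_infDist_pt (W.obstacle k)
  fun_prop

theorem cast_sq {m : SignType} (hm : m ≠ 0) : (m : ℝ) ^ 2 = 1 := by
  match m, hm with
  | 1, _ => simp
  | -1, _ => simp

theorem velocity_zero (x : Pt n) (k : Fin b) (z : Pt n) :
    W.velocity ⟨x, k, 0, z⟩ = W.nominal x := by
  simp [velocity]

theorem velocity_of_ne_zero (hm : m ≠ 0) : W.velocity ⟨x, k, m, z⟩ =
    (W.alpha x k * W.mu x k z m) • W.kappa x k z m + (1 - W.alpha x k) • W.nominal x := by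
  simp only [velocity, cast_sq hm, one_mul]

/-- The domain on which the avoidance control is regular. -/
def regularSet (W : Workspace n b) (k : Fin b) (z : Pt n) (m : SignType) : Set (Pt n) :=
  {x | W.r k ≤ ‖x - W.c k‖ ∧ x ≠ W.virtualDest k z m}

theorem continuousOn_theta (hW : W.Valid) :
    ContinuousOn (fun x => W.theta x k) (W.regularSet k z m) := by
  refine Real.continuous_arcsin.comp_continuousOn (ContinuousOn.div (by fun_prop) (by fun_prop) ?_)
  exact fun x hx => (hW.norm_sub_pos hx.1).ne'

theorem continuousOn_beta (hW : W.Valid) :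
    ContinuousOn (fun x => W.beta x k z m) (W.regularSet k z m) := by
  intro x hx
  simp only [beta_eq hW]
  have h1 : W.c k - x ≠ 0 := by
    rw [← norm_pos_iff, norm_sub_rev]; exact hW.norm_sub_pos hx.1
  have h2 : W.virtualDest k z m - x ≠ 0 := sub_ne_zero.2 hx.2.symm
  exact ((InnerProductGeometry.continuousAt_angle h1 h2).comp_of_eq
    (f := fun x => (W.c k - x, W.virtualDest k z m - x)) (by fun_prop) rfl).continuousWithinAt

theorem continuousOn_mu (hW : W.Valid) :
    ContinuousOn (fun x => W.mu x k z m) (W.regularSet k z m) := by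
  refine continuousOn_const.add ((continuousOn_const.div (by fun_prop) fun x hx => ?_).mul
    ((continuousOn_beta hW).div (continuousOn_theta hW) fun x hx => (hW.theta_pos hx.1).ne'))
  exact norm_ne_zero_iff.2 (sub_ne_zero.2 hx.2)

theorem continuousOn_tau (hW : W.Valid) :
    ContinuousOn (fun x => W.tau x k z m) (W.regularSet k z m) := by
  refine ((ContinuousOn.norm ?_).mul (Real.continuous_sin.comp_continuousOn
    ((continuousOn_theta hW).sub (continuousOn_beta hW)))).div
    (Real.continuous_sin.comp_continuousOn (continuousOn_theta hW))
    fun x hx => (hW.sin_theta_pos hx.1).ne'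
  simp only [kappaBar]
  fun_prop

theorem continuousOn_inv_norm (hW : W.Valid) :
    ContinuousOn (fun x => ‖W.c k - x‖⁻¹) (W.regularSet k z m) := by
  refine ContinuousOn.inv₀ (by fun_prop) fun x hx => ?_
  rw [norm_sub_rev]
  exact (hW.norm_sub_pos hx.1).ne'

theorem continuous_nominal : Continuous fun x => W.nominal x := by
  simp only [nominal]; fun_prop

theorem continuousOn_velocity (hW : W.Valid) (hm : m ≠ 0) :
    ContinuousOn (fun x => W.velocity ⟨x, k, m, z⟩) (W.regularSet k z m) := by
  simp only [velocity_of_ne_zero hm, kappa, kappaBar]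
  have h1 := (continuous_alpha hW k).continuousOn (s := W.regularSet k z m)
  have h2 := continuousOn_mu hW (k := k) (z := z) (m := m)
  have h3 := continuousOn_tau hW (k := k) (z := z) (m := m)
  have h4 := continuousOn_inv_norm hW (k := k) (z := z) (m := m)
  have h5 := (continuous_nominal (W := W)).continuousOn (s := W.regularSet k z m)
  fun_prop

/-- The linear growth rate of the components of the position that are orthogonal to the axis of
the hat. -/
def growthRate (W : Workspace n b) (k : Fin b) (z : Pt n) (m : SignType) (x : Pt n) : ℝ :=
  W.alpha x k * W.mu x k z m * (W.tau x k z m * ‖W.c k - x‖⁻¹ - W.γ) - (1 - W.alpha x k) * W.γ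

theorem continuousOn_growthRate (hW : W.Valid) :
    ContinuousOn (W.growthRate k z m) (W.regularSet k z m) := by
  have h1 := (continuous_alpha hW k).continuousOn (s := W.regularSet k z m)
  have h2 := continuousOn_mu hW (k := k) (z := z) (m := m)
  have h3 := continuousOn_tau hW (k := k) (z := z) (m := m)
  have h4 := continuousOn_inv_norm hW (k := k) (z := z) (m := m)
  unfold growthRate
  fun_prop

/-- The control is a combination of `z - c`, `x - c` and `xd - c`, where `z` is the virtual
destination; a vector `v` orthogonal to the axis kills the last. What remains is a linear equation
whose forcing has the sign of `⟪v, z - c⟫`. -/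
theorem inner_velocity (hm : m ≠ 0) {v : Pt n} (hv : inner ℝ v (W.xd - W.c k) = (0 : ℝ)) :
    inner ℝ v (W.velocity ⟨x, k, m, z⟩) =
      W.alpha x k * W.mu x k z m * W.γ * inner ℝ v (W.virtualDest k z m - W.c k) +
        W.growthRate k z m x * inner ℝ v (x - W.c k) := by
  have h1 : W.velocity ⟨x, k, m, z⟩ =
      (W.alpha x k * W.mu x k z m * W.γ) • (W.virtualDest k z m - W.c k) +
        W.growthRate k z m x • (x - W.c k) + ((1 - W.alpha x k) * W.γ) • (W.xd - W.c k) := by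
    rw [velocity_of_ne_zero hm, kappa, kappaBar, nominal, growthRate]
    module
  rw [h1, inner_add_right, inner_add_right, real_inner_smul_right, real_inner_smul_right,
    real_inner_smul_right, hv]
  ring

/-! ### The control during a maneuver and on the boundary of the half region -/

namespace Maneuver

variable (hW : W.Valid) (M : W.Maneuver k z m H h e₁ e₂ x P q)
include hW M

omit hW in
theorem ne_virtualDest : x ≠ W.virtualDest k z m :=
  sub_ne_zero.1 (norm_pos_iff.1 (M.frame.norm_sub_vertex_pos M.region M.frame.h_pos M.frame.z_eq))

theorem side_pos : 0 < h * P - W.r k * q :=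
  HybridNav.side_pos M.frame.r_pos M.frame.h_pos M.frame.h_lt M.region.nonpos M.region.side
    (M.frame.out_sq hW M.region)

/-- The Gram determinant of `c - x` and `z - x`, for the virtual destination `z`, is the square of
`h P - r q`. -/
theorem sin_beta_pos : 0 < Real.sin (W.beta x k z m) := by
  have h1 := M.side_pos hW
  have hx := M.region.pos_eq
  have hz := M.frame.z_eq
  rw [beta_eq hW]
  have h2 := InnerProductGeometry.sin_angle_mul_norm_mul_norm (W.c k - x) (W.virtualDest k z m - x)
  have hd1 : W.c k - x = (-P) • e₁ + (-q) • e₂ := by rw [hx]; module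
  have hd2 : W.virtualDest k z m - x = (W.r k - P) • e₁ + (h - q) • e₂ := by
    rw [hx]
    nth_rewrite 1 [hz]
    module
  have h3 : inner ℝ (W.c k - x) (W.c k - x) *
      inner ℝ (W.virtualDest k z m - x) (W.virtualDest k z m - x) -
      inner ℝ (W.c k - x) (W.virtualDest k z m - x) *
        inner ℝ (W.c k - x) (W.virtualDest k z m - x) = (h * P - W.r k * q) ^ 2 := by
    rw [hd1, hd2, M.frame.inner_comb, M.frame.inner_comb, M.frame.inner_comb]
    ring
  rw [h3, Real.sqrt_sq h1.le] at h2
  rw [← h2] at h1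
  exact pos_of_mul_pos_left h1 (by positivity)

theorem isLocallyOptimal_kappa : W.IsLocallyOptimal x k (W.kappa x k z m) := by
  have h1 := M.side_pos hW
  have h2 := h1.ne'
  -- The coefficients solve the planar linear system for `xd - x` by Cramer's rule; `t ≥ 0` is
  -- exactly the side condition.
  refine Workspace.isLocallyOptimal_kappa hW (M.region.r_le_norm_sub hW) (M.sin_beta_pos hW)
    M.ne_virtualDest (t := (H * P - W.r k * q) / (h * P - W.r k * q))
    (s := (W.r k - P) * (H - h) / (h * P - W.r k * q)) ?_ ?_
  · exact div_nonneg (sub_nonneg.2 M.region.side) h1.le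
  · rw [M.frame.xd_eq, M.region.pos_eq]
    nth_rewrite 1 [M.frame.z_eq]
    generalize hg : h * P - W.r k * q = g at h2 ⊢
    have e1 : W.r k - P = (H * P - W.r k * q) / g * (W.r k - P) -
        (W.r k - P) * (H - h) / g * P := by
      field_simp; rw [← hg]; ring
    have e2 : H - q = (H * P - W.r k * q) / g * (h - q) - (W.r k - P) * (H - h) / g * q := by
      field_simp; rw [← hg]; ring
    match_scalars
    · ring
    · linear_combination e1
    · linear_combination e2

theorem isLocallyOptimal_velocity (hd : W.dist x k ≤ W.rbar k - W.ε) :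
    W.IsLocallyOptimal x k (W.velocity ⟨x, k, m, z⟩) := by
  rw [velocity_of_ne_zero M.mode_ne, alpha_eq_one hW hd, sub_self, zero_smul, add_zero, one_mul]
  exact (M.isLocallyOptimal_kappa hW).smul
    (zero_lt_one.trans_le (one_le_mu hW (M.region.r_le_norm_sub hW)))

/-- On the boundary of the active region, the avoidance control is the nominal control. -/
theorem velocity_eq_nominal (hb : P = W.r k ∨ ‖x - W.c k‖ = W.r k + W.rbar k) :
    W.velocity ⟨x, k, m, z⟩ = W.nominal x := by
  have hx := M.region.r_le_norm_sub hW
  rw [velocity_of_ne_zero M.mode_ne]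
  rcases hb with rfl | hb
  · have F := M.frame
    have hq := M.region.nonpos
    have hh := F.h_pos
    have hhq : 0 < h - q := by linarith
    have hnz : ‖x - W.virtualDest k z m‖ = h - q := by
      rw [← sq_eq_sq₀ (norm_nonneg _) hhq.le, F.norm_sub_sq M.region.pos_eq F.z_eq]
      ring
    have hcx : 0 < ‖W.c k - x‖ := by rw [norm_sub_rev]; exact hW.norm_sub_pos hx
    have hθ : ‖W.c k - x‖ * Real.cos (W.theta x k) = -q := by
      rw [norm_sub_rev, hW.norm_mul_cos_theta hx, F.norm_sub_center_sq M.region.pos_eq,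
        add_sub_cancel_left, Real.sqrt_sq_eq_abs, abs_of_nonpos hq]
    have hcos : Real.cos (W.beta x k z m) = Real.cos (W.theta x k) := by
      rw [beta_eq hW, InnerProductGeometry.cos_angle, F.inner_sub_sub M.region.pos_eq F.z_eq,
        norm_sub_rev (W.virtualDest k z m), hnz, div_eq_iff (by positivity)]
      linear_combination -(h - q) * hθ
    -- The virtual destination is seen along the tangent.
    have hβ : W.beta x k z m = W.theta x k :=
      Real.injOn_cos ⟨InnerProductGeometry.angle_nonneg _ _,
        InnerProductGeometry.angle_le_pi _ _⟩ ⟨(hW.theta_pos hx).le,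
        (theta_le_pi_div_two x k).trans (by linarith [Real.pi_pos])⟩ hcos
    have hτ : W.tau x k z m = 0 := by simp [tau, hβ]
    have hκ : W.mu x k z m • W.kappa x k z m = W.nominal x := by
      rw [mu, kappa, hτ, hβ, div_self (hW.theta_pos hx).ne', hnz, kappaBar, nominal, F.xd_eq,
        F.height]
      nth_rewrite 1 [F.z_eq]
      rw [M.region.pos_eq]
      match_scalars <;> field_simp <;> ring
    rw [mul_smul, hκ]
    module
  · have hα : W.alpha x k = 0 := by
      rw [alpha_eq hW, hW.dist_eq hx, hb]
      simp
    rw [hα]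
    module

end Maneuver

end Workspace

namespace Workspace

variable {n b : ℕ} {W : Workspace n b} {k j : Fin b} {z x : Pt n} {H h P q : ℝ} {e₁ e₂ : Pt n}
  {m : SignType}

/-! ### Active regions of different obstacles are disjoint -/

/-- On the segment from the destination to a hidden point there is a point of the obstacle, after
which the segment is hidden. -/
theorem exists_foot (hW : W.Valid) (hx : x ∈ W.shadow k W.xd) :
    ∃ s : ℝ, 0 < s ∧ s ≤ 1 ∧ ‖W.xd + s • (x - W.xd) - W.c k‖ ≤ W.r k ∧
      ∀ s' : ℝ, s ≤ s' → W.xd + s' • (x - W.xd) ∈ W.freeSpace →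
        W.xd + s' • (x - W.xd) ∈ W.shadow k W.xd := by
  obtain ⟨⟨-, hcone⟩, hthales, hne⟩ := hx
  have hr := hW.r_pos k
  have hD := hW.r_lt_norm_xd_sub k
  have hcos := hW.norm_mul_cos_theta hD.le
  have hd : 0 < ‖x - W.xd‖ := norm_pos_iff.2 (sub_ne_zero.2 hne)
  have hroot : 0 < √(‖W.xd - W.c k‖ ^ 2 - W.r k ^ 2) := Real.sqrt_pos.2 (by nlinarith)
  have hsq : √(‖W.xd - W.c k‖ ^ 2 - W.r k ^ 2) ^ 2 = ‖W.xd - W.c k‖ ^ 2 - W.r k ^ 2 :=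
    Real.sq_sqrt (by nlinarith)
  have hcone' := hcone
  rw [mul_right_comm, norm_sub_rev, hcos] at hcone
  set I : ℝ := inner ℝ (W.c k - W.xd) (x - W.xd) with hI
  have hIpos : 0 < I := (mul_pos hroot hd).trans_le hcone
  have hthales' : ∀ s : ℝ, inner ℝ (W.c k - (W.xd + s • (x - W.xd)))
      (W.xd - (W.xd + s • (x - W.xd))) = s * (s * ‖x - W.xd‖ ^ 2 - I) := by
    intro s
    have h1 : W.c k - (W.xd + s • (x - W.xd)) = (W.c k - W.xd) - s • (x - W.xd) := by abel
    have h2 : W.xd - (W.xd + s • (x - W.xd)) = -(s • (x - W.xd)) := by abel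
    rw [h1, h2, inner_neg_right, inner_sub_left, real_inner_smul_right, real_inner_smul_right,
      real_inner_smul_left, real_inner_self_eq_norm_sq, ← hI]
    ring
  -- The parameter of the foot of the perpendicular from the center to the ray; the Thales condition
  -- says that the foot does not come after `x`.
  refine ⟨I / ‖x - W.xd‖ ^ 2, by positivity, ?_, ?_, fun s hs hfree => ?_⟩
  · have h1 := hthales' 1
    rw [one_smul, add_sub_cancel] at h1
    rw [h1] at hthales
    rw [div_le_one (by positivity)]
    linarith
  · refine le_of_sq_le_sq ?_ hr.le
    have h1 : W.xd + (I / ‖x - W.xd‖ ^ 2) • (x - W.xd) - W.c k =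
        (I / ‖x - W.xd‖ ^ 2) • (x - W.xd) - (W.c k - W.xd) := by abel
    rw [h1, norm_sub_sq_real, norm_smul, real_inner_smul_left, real_inner_comm (W.c k - W.xd),
      ← hI, mul_pow, Real.norm_eq_abs, sq_abs, norm_sub_rev (W.c k)]
    have h2 := pow_le_pow_left₀ (by positivity) hcone 2
    rw [mul_pow, hsq] at h2
    have h3 : ‖W.xd - W.c k‖ ^ 2 - W.r k ^ 2 ≤ I ^ 2 / ‖x - W.xd‖ ^ 2 := by
      rwa [le_div_iff₀ (by positivity)]
    have h4 : (I / ‖x - W.xd‖ ^ 2) ^ 2 * ‖x - W.xd‖ ^ 2 - 2 * (I / ‖x - W.xd‖ ^ 2 * I) =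
        -(I ^ 2 / ‖x - W.xd‖ ^ 2) := by
      field_simp; ring
    linarith
  · have hs0 : 0 < s := (by positivity : 0 < I / ‖x - W.xd‖ ^ 2).trans_le hs
    refine ⟨⟨hfree, ?_⟩, ?_, fun h => ?_⟩
    · rw [add_sub_cancel_left, norm_smul, real_inner_smul_right, Real.norm_of_nonneg hs0.le]
      have := mul_le_mul_of_nonneg_left hcone' hs0.le
      linarith
    · rw [hthales']
      rw [div_le_iff₀ (by positivity)] at hs
      exact mul_nonneg hs0.le (sub_nonneg.2 hs)
    · rw [add_eq_left, smul_eq_zero] at h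
      exact h.elim hs0.ne' (sub_ne_zero.2 hne)

/-- The segment from the destination to `x` meets both obstacles, say `k` first. A crossing point
with the boundary of `j` is then hidden by `k`, so the bound on `rbar k` applies to `j`; but by
convexity this point is within `r k + rbar k` of the center of `k`, which contradicts it. -/
theorem eq_of_mem_active (hW : W.Valid) (hk : x ∈ W.active k W.xd) (hj : x ∈ W.active j W.xd) :
    k = j := by
  by_contra hkj
  obtain ⟨s, hs0, hs1, hs, hshadow⟩ := exists_foot hW hk.1
  obtain ⟨s', hs0', hs1', hs', hshadow'⟩ := exists_foot hW hj.1
  wlog hss : s ≤ s' generalizing k j s s'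
  · exact this hj hk (Ne.symm hkj) s' hs0' hs1' hs' hshadow' s hs0 hs1 hs hshadow (le_of_not_ge hss)
  have hdis := hW.disjoint k j hkj
  let f : ℝ → ℝ := fun σ => ‖W.xd + σ • (x - W.xd) - W.c j‖
  have hf : Continuous f := by fun_prop
  have hfs : W.r j ≤ f s := by
    have h1 := norm_sub_le_norm_sub_add_norm_sub (W.c k) (W.xd + s • (x - W.xd)) (W.c j)
    rw [norm_sub_rev (W.c k) (W.xd + _)] at h1
    change _ ≤ ‖W.xd + s • (x - W.xd) - W.c j‖
    linarith
  obtain ⟨σ, ⟨hσ1, hσ2⟩, hσ⟩ := intermediate_value_Icc' hss hf.continuousOn ⟨hs', hfs⟩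
  have hσ : ‖W.xd + σ • (x - W.xd) - W.c j‖ = W.r j := hσ
  have hfree : W.xd + σ • (x - W.xd) ∈ W.freeSpace := by
    refine hW.mem_freeSpace.2 fun i => ?_
    rcases eq_or_ne i j with rfl | hij
    · exact hσ.ge
    · have h1 := norm_sub_le_norm_sub_add_norm_sub (W.c i) (W.xd + σ • (x - W.xd)) (W.c j)
      rw [norm_sub_rev (W.c i) (W.xd + _)] at h1
      have := hW.disjoint i j hij
      linarith
  have hhid : j ∈ W.hidden k := by
    refine ⟨Ne.symm hkj, _, hshadow σ hσ1 hfree, ?_⟩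
    rw [obstacle, frontier_closedBall _ (hW.r_pos j).ne', Metric.mem_sphere, dist_eq_norm, hσ]
  have hconv : Convex ℝ (AffineMap.lineMap W.xd x ⁻¹'
      Metric.closedBall (W.c k) (W.r k + W.rbar k) : Set ℝ) :=
    (convex_closedBall _ _).affine_preimage _
  have hmem : ∀ σ : ℝ, AffineMap.lineMap W.xd x σ = W.xd + σ • (x - W.xd) := fun σ => by
    rw [AffineMap.lineMap_apply, vsub_eq_sub, vadd_eq_add, add_comm]
  have h1 : s ∈ (AffineMap.lineMap W.xd x ⁻¹'
      Metric.closedBall (W.c k) (W.r k + W.rbar k) : Set ℝ) := by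
    rw [mem_preimage, hmem, Metric.mem_closedBall, dist_eq_norm]
    linarith [hW.rbar_pos k]
  have h2 : (1 : ℝ) ∈ (AffineMap.lineMap W.xd x ⁻¹'
      Metric.closedBall (W.c k) (W.r k + W.rbar k) : Set ℝ) := by
    rw [mem_preimage, hmem, one_smul, add_sub_cancel]
    exact hk.2
  have h3 := hconv.ordConnected.out h1 h2 ⟨hσ1, hσ2.trans hs1'⟩
  rw [mem_preimage, hmem, Metric.mem_closedBall, dist_eq_norm] at h3
  have h4 := norm_sub_le_norm_sub_add_norm_sub (W.c k) (W.xd + σ • (x - W.xd)) (W.c j)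
  rw [norm_sub_rev (W.c k) (W.xd + _)] at h4
  linarith [hW.rbar_lt k j hhid]

/-! ### Invariance along flows -/

/-- Along an avoidance flow, the position does not cross a hyperplane through the axis of the hat
that has the virtual destination on the same side. -/
theorem inner_nonneg_of_flow (hW : W.Valid) (hm : m ≠ 0) {γ : ℝ → Pt n} {s t : ℝ} (hst : s ≤ t)
    (hac : AbsolutelyContinuousOnInterval γ s t) (hreg : ∀ τ ∈ Icc s t, γ τ ∈ W.regularSet k z m)
    (hder : ∀ᵐ τ : ℝ, τ ∈ Ioo s t → HasDerivAt γ (W.velocity ⟨γ τ, k, m, z⟩) τ) {v : Pt n}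
    (hv : inner ℝ v (W.xd - W.c k) = (0 : ℝ))
    (hz : 0 ≤ inner ℝ v (W.virtualDest k z m - W.c k)) (hs : 0 ≤ inner ℝ v (γ s - W.c k)) :
    0 ≤ inner ℝ v (γ t - W.c k) := by
  have hγ : ContinuousOn γ (Icc s t) := by simpa [uIcc_of_le hst] using hac.continuousOn
  -- Where the component is negative, an upper bound `K` of the growth rate bounds its derivative
  -- from below by `K` times the component.
  obtain ⟨K, hK⟩ := isCompact_Icc.exists_bound_of_continuousOn
    ((continuousOn_growthRate hW).comp hγ hreg)
  refine nonneg_of_deriv_ge (K := K) hst (absolutelyContinuousOnInterval_inner_sub hac v (W.c k))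
    hs ?_
  filter_upwards [hder] with τ hτ hmem hneg
  have hτ' := Ioo_subset_Icc_self hmem
  refine ⟨inner ℝ v (W.velocity ⟨γ τ, k, m, z⟩), ?_, ?_⟩
  · exact ((innerSL ℝ v).hasFDerivAt.comp_hasDerivAt τ ((hτ hmem).sub_const (W.c k)))
  · rw [inner_velocity hm hv]
    have h1 : W.growthRate k z m (γ τ) ≤ K := (le_abs_self _).trans (hK τ hτ')
    have h2 : 0 ≤ W.alpha (γ τ) k := by rw [alpha_eq hW]; exact le_max_left _ _
    have h3 := zero_le_one.trans (one_le_mu hW (z := z) (m := m) (hreg τ hτ').1)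
    have h4 := hW.γ_pos
    have h5 : 0 ≤ W.alpha (γ τ) k * W.mu (γ τ) k z m * W.γ *
      inner ℝ v (W.virtualDest k z m - W.c k) := by positivity
    nlinarith

/-- On the side of the virtual destination, no point of the line through the virtual destination
and the center is hidden. -/
theorem TangentFrame.false_of_collinear (hW : W.Valid) (F : W.TangentFrame k z H h e₁ e₂)
    (hx : x = W.c k + (P • e₁ + q • e₂)) (hact : x ∈ W.active k z) (hside : W.r k * q ≤ H * P)
    (hcol : h * P = W.r k * q) : False := by
  obtain ⟨⟨⟨hfree, hcone⟩, hthales, hne⟩, -⟩ := hact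
  have hr := F.r_pos
  have hh := F.h_pos
  rw [mul_right_comm, F.norm_mul_cos hW hh F.z_eq, F.inner_center_sub hx F.z_eq] at hcone
  rw [F.inner_sub_sub hx F.z_eq] at hthales
  have hN : 0 < ‖x - z‖ := norm_pos_iff.2 (sub_ne_zero.2 hne)
  have hP : 0 ≤ P := by
    have : 0 ≤ (H - h) * P := by linarith
    exact nonneg_of_mul_nonneg_right this (sub_pos.2 F.h_lt)
  obtain ⟨l, rfl⟩ : ∃ l, P = l * W.r k := ⟨P / W.r k, by field_simp⟩
  have hq : q = l * h := mul_left_cancel₀ hr.ne' (by linarith)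
  subst hq
  have hl : 0 ≤ l := nonneg_of_mul_nonneg_left hP hr
  have h1 : 0 < (1 - l) * (W.r k ^ 2 + h ^ 2) := by
    have := mul_pos hh hN
    linarith
  have h2 : 0 ≤ -l * ((1 - l) * (W.r k ^ 2 + h ^ 2)) := by linarith
  have h3 : l = 0 := by nlinarith
  have h4 := hW.norm_sub_pos (hW.mem_freeSpace.1 hfree k)
  rw [hx, h3] at h4
  simp at h4

namespace TangentFrame

theorem inner_e₁ (F : W.TangentFrame k z H h e₁ e₂) (p q : ℝ) :
    inner ℝ e₁ (p • e₁ + q • e₂) = p := by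
  have := F.inner_comb 1 0 p q
  simpa using this

theorem inner_e₂ (F : W.TangentFrame k z H h e₁ e₂) (p q : ℝ) :
    inner ℝ e₂ (p • e₁ + q • e₂) = q := by
  have := F.inner_comb 0 1 p q
  simpa using this

/-- The flow set is only prescribed on the interior of a time slice; closedness carries the
invariant to the final time. -/
theorem isClosed_inHalfRegion (F : W.TangentFrame k z H h e₁ e₂) :
    IsClosed {x | ∃ P q, W.InHalfRegion k H e₁ e₂ x P q} := by
  have : {x | ∃ P q, W.InHalfRegion k H e₁ e₂ x P q} =
      {x | x = W.c k + (inner ℝ e₁ (x - W.c k) • e₁ + inner ℝ e₂ (x - W.c k) • e₂)} ∩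
      {x | inner ℝ e₁ (x - W.c k) ≤ W.r k} ∩ {x | inner ℝ e₂ (x - W.c k) ≤ 0} ∩
      {x | W.r k * inner ℝ e₂ (x - W.c k) ≤ H * inner ℝ e₁ (x - W.c k)} ∩ W.freeSpace ∩
      {x | ‖x - W.c k‖ ≤ W.r k + W.rbar k} := by
    ext x
    constructor
    · rintro ⟨P, q, h1, h2, h3, h4, h5, h6⟩
      have hd : x - W.c k = P • e₁ + q • e₂ := by rw [h1, add_sub_cancel_left]
      have hP : inner ℝ e₁ (x - W.c k) = P := by rw [hd, F.inner_e₁]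
      have hq : inner ℝ e₂ (x - W.c k) = q := by rw [hd, F.inner_e₂]
      refine ⟨⟨⟨⟨⟨?_, ?_⟩, ?_⟩, ?_⟩, h5⟩, h6⟩ <;> simp only [mem_ofPred_eq, hP, hq] <;> assumption
    · rintro ⟨⟨⟨⟨⟨h1, h2⟩, h3⟩, h4⟩, h5⟩, h6⟩
      exact ⟨_, _, h1, h2, h3, h4, h5, h6⟩
  rw [this]
  refine (((((isClosed_eq ?_ ?_).inter (isClosed_le ?_ ?_)).inter (isClosed_le ?_ ?_)).inter
    (isClosed_le ?_ ?_)).inter isClosed_freeSpace).inter (isClosed_le ?_ ?_) <;> fun_prop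

end TangentFrame

theorem flowAvoid_subset_regularSet (hW : W.Valid) : W.flowAvoid k z m ⊆ W.regularSet k z m :=
  fun _ hx => ⟨hW.mem_freeSpace.1 hx.1.1.1.1 k, hx.1.1.2.2⟩

/-- A maneuver is preserved by the flow. -/
theorem Maneuver.flow (hW : W.Valid) {γ : ℝ → Pt n} {s t : ℝ} (hst : s < t)
    (M : W.Maneuver k z m H h e₁ e₂ (γ s) P q)
    (hac : AbsolutelyContinuousOnInterval γ s t) (hmem : ∀ τ ∈ Ioo s t, γ τ ∈ W.flowAvoid k z m)
    (hder : ∀ᵐ τ : ℝ, τ ∈ Ioo s t → HasDerivAt γ (W.velocity ⟨γ τ, k, m, z⟩) τ) :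
    ∃ P q, W.Maneuver k z m H h e₁ e₂ (γ t) P q := by
  have F := M.frame
  have hm := M.mode_ne
  have hr := F.r_pos
  have hγ : ContinuousOn γ (Icc s t) := by simpa [uIcc_of_le hst.le] using hac.continuousOn
  have hreg : ∀ τ ∈ Ico s t, γ τ ∈ W.regularSet k z m := by
    intro τ hτ
    rcases hτ.1.eq_or_lt with rfl | h1
    · exact flowAvoid_subset_regularSet hW (M.mem_flowAvoid hW)
    · exact flowAvoid_subset_regularSet hW (hmem τ ⟨h1, hτ.2⟩)
  have hinv : ∀ τ ∈ Ico s t, ∀ v : Pt n, inner ℝ v (W.xd - W.c k) = (0 : ℝ) →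
      0 ≤ inner ℝ v (W.virtualDest k z m - W.c k) → 0 ≤ inner ℝ v (γ s - W.c k) →
      0 ≤ inner ℝ v (γ τ - W.c k) := by
    intro τ hτ v h1 h2 h3
    refine inner_nonneg_of_flow hW hm hτ.1 (hac.mono ?_) (fun σ hσ => hreg σ ⟨hσ.1, ?_⟩) ?_
      h1 h2 h3
    · rw [uIcc_of_le hτ.1, uIcc_of_le hst.le]
      exact Icc_subset_Icc_right hτ.2.le
    · exact hσ.2.trans_lt hτ.2
    · filter_upwards [hder] with σ h hσ
      exact h ⟨hσ.1, hσ.2.trans hτ.2⟩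
  have hz : W.virtualDest k z m - W.c k = W.r k • e₁ + h • e₂ := by
    nth_rewrite 1 [F.z_eq]; rw [add_sub_cancel_left]
  have hxd : W.xd - W.c k = W.r k • e₁ + H • e₂ := by rw [F.xd_eq, add_sub_cancel_left]
  have hs : γ s - W.c k = P • e₁ + q • e₂ := by rw [M.region.pos_eq, add_sub_cancel_left]
  -- Let `w` be the component of `γ τ - c` orthogonal to the plane of the frame. The fixed normal
  -- `-w` satisfies all sign conditions of `hinv` with equality, so `-‖w‖² ≥ 0`.
  have hplanar : ∀ τ ∈ Ico s t, γ τ =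
      W.c k + (inner ℝ e₁ (γ τ - W.c k) • e₁ + inner ℝ e₂ (γ τ - W.c k) • e₂) := by
    intro τ hτ
    set P' : ℝ := inner ℝ e₁ (γ τ - W.c k) with hP'
    set q' : ℝ := inner ℝ e₂ (γ τ - W.c k) with hq'
    set w := γ τ - W.c k - (P' • e₁ + q' • e₂) with hw
    have h1 : inner ℝ w e₁ = (0 : ℝ) := by
      rw [real_inner_comm, hw, inner_sub_right, F.inner_e₁, ← hP', sub_self]
    have h2 : inner ℝ w e₂ = (0 : ℝ) := by
      rw [real_inner_comm, hw, inner_sub_right, F.inner_e₂, ← hq', sub_self]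
    have h3 : ∀ p q : ℝ, inner ℝ (-w) (p • e₁ + q • e₂) = (0 : ℝ) := fun p q => by
      rw [inner_neg_left, inner_add_right, real_inner_smul_right, real_inner_smul_right, h1, h2]
      ring
    have h4 := hinv τ hτ (-w) (by rw [hxd, h3]) (by rw [hz, h3]) (by rw [hs, h3])
    have h5 : γ τ - W.c k = w + (P' • e₁ + q' • e₂) := by rw [hw]; abel
    rw [h5, inner_add_right, h3, inner_neg_left, add_zero, real_inner_self_eq_norm_sq] at h4
    have h6 : w = 0 := by
      rw [← norm_eq_zero]
      nlinarith [norm_nonneg w]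
    rw [h6, zero_add] at h5
    rw [← h5]; abel
  have hnormal : ∀ (a p q : ℝ), inner ℝ (a • e₁ - W.r k • e₂) (p • e₁ + q • e₂) =
      a * p - W.r k * q := fun a p q => by
    have h1 : a • e₁ - W.r k • e₂ = a • e₁ + (-W.r k) • e₂ := by module
    rw [h1, F.inner_comb]; ring
  have hside : ∀ τ ∈ Ico s t,
      W.r k * inner ℝ e₂ (γ τ - W.c k) ≤ H * inner ℝ e₁ (γ τ - W.c k) := by
    intro τ hτ
    have h1 := hinv τ hτ (H • e₁ - W.r k • e₂) (by rw [hxd, hnormal]; ring)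
      (by rw [hz, hnormal]; nlinarith [F.h_lt])
      (by rw [hs, hnormal]; exact sub_nonneg.2 M.region.side)
    rw [inner_sub_left, real_inner_smul_left, real_inner_smul_left] at h1
    linarith
  have hpos : ∀ τ ∈ Ioo s t, W.InHalfRegion k H e₁ e₂ (γ τ) (inner ℝ e₁ (γ τ - W.c k))
      (inner ℝ e₂ (γ τ - W.c k)) := by
    intro τ hτ
    have hτ' := Ioo_subset_Ico_self hτ
    refine F.inHalfRegion_of_mem_active hW F.h_pos F.z_eq (hplanar τ hτ') (hside τ hτ') ?_
      (hmem τ hτ).1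
    -- The hat axis controls one side only; the flow set also contains points across the line from
    -- the virtual destination to the center. To get there, the path would have to cross that line,
    -- where no point of the flow set on this side of the hat axis lies.
    by_contra! hneg
    have hg : ContinuousOn (fun σ => h * inner ℝ e₁ (γ σ - W.c k) -
        W.r k * inner ℝ e₂ (γ σ - W.c k)) (Icc s τ) := by
      have := hγ.mono (Icc_subset_Icc_right hτ.2.le)
      fun_prop
    obtain ⟨σ, ⟨hσ1, hσ2⟩, hσ⟩ := intermediate_value_Icc' hτ.1.le hg
      (show (0 : ℝ) ∈ Icc _ _ from ⟨by linarith, by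
        simp only [hs, F.inner_e₁, F.inner_e₂]
        exact (M.side_pos hW).le⟩)
    simp only at hσ
    rcases hσ1.eq_or_lt with rfl | hσ1
    · rw [hs, F.inner_e₁, F.inner_e₂] at hσ
      exact (M.side_pos hW).ne' hσ
    · have hσ' : σ ∈ Ioo s t := ⟨hσ1, hσ2.trans_lt hτ.2⟩
      exact F.false_of_collinear hW (hplanar σ (Ioo_subset_Ico_self hσ')) (hmem σ hσ').1
        (hside σ (Ioo_subset_Ico_self hσ')) (sub_eq_zero.1 hσ)
  have hcl : γ t ∈ closure (γ '' Ioo s t) := by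
    have h1 : ContinuousOn γ (closure (Ioo s t)) := by rwa [closure_Ioo hst.ne]
    refine h1.image_closure ⟨t, ?_, rfl⟩
    rw [closure_Ioo hst.ne]
    exact ⟨hst.le, le_rfl⟩
  have hsub : γ '' Ioo s t ⊆ {x | ∃ P q, W.InHalfRegion k H e₁ e₂ x P q} := by
    rintro _ ⟨τ, hτ, rfl⟩
    exact ⟨_, _, hpos τ hτ⟩
  obtain ⟨P', q', hR⟩ := closure_minimal hsub F.isClosed_inHalfRegion hcl
  exact ⟨P', q', hm, M.dest, F, hR⟩

end Workspace

namespace Workspace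

variable {n b : ℕ} {W : Workspace n b} {T : Set (ℝ × ℕ)} {ξ : ℝ → ℕ → State n b}

/-! ### The invariant of solutions -/

/-- The position is that of an avoidance maneuver. -/
def InManeuver (W : Workspace n b) (s : State n b) : Prop :=
  ∃ H h e₁ e₂ P q, W.Maneuver s.obs s.vdest s.mode H h e₁ e₂ s.pos P q

/-- In the motion-to-destination mode, the position is not in the interior of an active region. -/
def AtMostEntering (W : Workspace n b) (x : Pt n) : Prop :=
  x ∈ W.flowDest ∨ ∀ k, x ∈ W.active k W.xd →
    ‖W.c k - W.xd‖ * ‖x - W.xd‖ * Real.cos (W.theta W.xd k) =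
      inner ℝ (W.c k - W.xd) (x - W.xd) ∨ ‖x - W.c k‖ = W.r k + W.rbar k

/-- The states that a solution can attain, except for an exceptional initial state. -/
def Regular (W : Workspace n b) (s : State n b) : Prop :=
  (s.mode = 0 ∧ W.AtMostEntering s.pos) ∨ W.InManeuver s

theorem InManeuver.mode_ne {s : State n b} (hs : W.InManeuver s) : s.mode ≠ 0 := by
  obtain ⟨_, _, _, _, _, _, M⟩ := hs
  exact M.mode_ne

theorem InManeuver.mem_flowAvoid (hW : W.Valid) {s : State n b} (hs : W.InManeuver s) :
    s.pos ∈ W.flowAvoid s.obs s.vdest s.mode := by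
  obtain ⟨_, _, _, _, _, _, M⟩ := hs
  exact M.mem_flowAvoid hW

theorem Regular.inManeuver {s : State n b} (hs : W.Regular s) (hm : s.mode ≠ 0) :
    W.InManeuver s :=
  hs.resolve_left fun h => hm h.1

theorem inManeuver_of_mem_jumpMap (hW : W.Valid) {s s' : State n b} (hs : s.mode = 0)
    (hs' : s' ∈ W.jumpMap s) : W.InManeuver s' := by
  obtain ⟨hpos, ⟨hne, -⟩ | ⟨-, hact, hplan, hB⟩⟩ := hs'
  · exact absurd hs hne
  · unfold InManeuver
    rw [hpos]
    exact exists_maneuver hW hact hplan hB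

/-- This is where the second alternative of `AtMostEntering` is needed: nothing puts the exit
position in `flowDest`, but it is on the boundary of its own active region and in no other one. -/
theorem InManeuver.atMostEntering (hW : W.Valid) {s : State n b} (hs : W.InManeuver s)
    (hjump : s.pos ∈ W.jumpAvoid s.obs s.vdest s.mode) : W.AtMostEntering s.pos := by
  obtain ⟨_, _, _, _, _, _, M⟩ := hs
  refine Or.inr fun k hk => ?_
  obtain rfl := eq_of_mem_active hW hk (M.mem_active_xd hW)
  exact (M.boundary_of_mem_jumpAvoid hW hjump).imp_left (M.frame.cone_eq_of_eq_r hW M.region)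

theorem InManeuver.velocity_eq_nominal_of_mem_jumpAvoid (hW : W.Valid) {s : State n b}
    (hs : W.InManeuver s) (hjump : s.pos ∈ W.jumpAvoid s.obs s.vdest s.mode) :
    W.velocity s = W.nominal s.pos := by
  obtain ⟨_, _, _, _, _, _, M⟩ := hs
  exact M.velocity_eq_nominal hW (M.boundary_of_mem_jumpAvoid hW hjump)

theorem InManeuver.velocity_eq_nominal (hW : W.Valid) {s : State n b} (hs : W.InManeuver s)
    (hpos : W.AtMostEntering s.pos) : W.velocity s = W.nominal s.pos := by
  obtain ⟨_, _, _, _, _, _, M⟩ := hs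
  refine M.velocity_eq_nominal hW ?_
  rcases hpos with h | h
  · exact M.boundary_of_mem_flowDest hW h
  · exact (h _ (M.mem_active_xd hW)).imp_left (M.frame.eq_r_of_cone_eq hW M.region)

theorem velocity_of_mode_eq_zero {s : State n b} (hs : s.mode = 0) :
    W.velocity s = W.nominal s.pos := by
  obtain ⟨x, k, m, z⟩ := s
  obtain rfl : m = 0 := hs
  exact velocity_zero x k z

theorem isClosed_flowDest : IsClosed W.flowDest := isClosed_iInter fun _ => isClosed_closure

namespace IsSolution

variable (hξ : W.IsSolution T ξ)
include hξ

theorem continuousOn_pos {j : ℕ} {s t : ℝ} (hst : s ≤ t) (hsub : Icc s t ⊆ timeSlice T j) :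
    ContinuousOn (fun τ => (ξ τ j).pos) (Icc s t) := by
  have := (hξ.absCont j s t (by rwa [uIcc_of_le hst])).continuousOn
  rwa [uIcc_of_le hst] at this

theorem flow_mem_of_mem_Ioo {j : ℕ} {s t τ : ℝ} (hsub : Icc s t ⊆ timeSlice T j)
    (hτ : τ ∈ Ioo s t) : ξ τ j ∈ W.flowSet :=
  hξ.flow_mem j τ (interior_mono hsub (by rwa [interior_Icc]))

theorem pos_mem_flowDest {j : ℕ} {s t : ℝ} (hst : s < t) (hsub : Icc s t ⊆ timeSlice T j)
    (hmode : (ξ s j).mode = 0) {τ : ℝ} (hτ : τ ∈ Icc s t) : (ξ τ j).pos ∈ W.flowDest := by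
  have h1 := hξ.continuousOn_pos hst.le hsub
  rw [← closure_Ioo hst.ne] at h1
  rw [← closure_Ioo hst.ne] at hτ
  refine closure_minimal ?_ isClosed_flowDest (h1.image_closure ⟨τ, hτ, rfl⟩)
  rintro _ ⟨σ, hσ, rfl⟩
  have h2 := hξ.flow_mem_of_mem_Ioo hsub hσ
  have h3 := (hξ.const j s (hsub ⟨le_rfl, hst.le⟩) σ (hsub (Ioo_subset_Icc_self hσ))).2.1
  rcases h2 with h2 | h2
  · exact h2.2
  · exact absurd (h3.symm.trans hmode) h2.1

theorem inManeuver_of_flow (hW : W.Valid) {j : ℕ} {s t : ℝ} (hst : s < t)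
    (hsub : Icc s t ⊆ timeSlice T j) (hs : W.InManeuver (ξ s j)) : W.InManeuver (ξ t j) := by
  obtain ⟨H, h, e₁, e₂, P, q, M⟩ := hs
  have hmem : ∀ τ ∈ Icc s t, ξ τ j = ⟨(ξ τ j).pos, (ξ s j).obs, (ξ s j).mode, (ξ s j).vdest⟩ := by
    intro τ hτ
    obtain ⟨h1, h2, h3⟩ := hξ.const j s (hsub ⟨le_rfl, hst.le⟩) τ (hsub hτ)
    rw [h1, h2, h3]
  have hcongr := hmem t ⟨hst.le, le_rfl⟩
  obtain ⟨P', q', M'⟩ := M.flow (γ := fun τ => (ξ τ j).pos) hW hst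
    (hξ.absCont j s t (by rwa [uIcc_of_le hst.le])) (fun τ hτ => by
      have h1 := hξ.flow_mem_of_mem_Ioo hsub hτ
      rw [hmem τ (Ioo_subset_Icc_self hτ)] at h1
      rcases h1 with h1 | h1
      · exact absurd h1.1 M.mode_ne
      · exact h1.2) (by
      filter_upwards [hξ.flow_deriv j] with τ h1 hτ
      have h2 := h1 (interior_mono hsub (by rwa [interior_Icc]))
      rwa [hmem τ (Ioo_subset_Icc_self hτ)] at h2)
  rw [hcongr]
  exact ⟨H, h, e₁, e₂, P', q', M'⟩

theorem regular_of_flow (hW : W.Valid) {j : ℕ} {s t : ℝ} (hst : s < t)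
    (hsub : Icc s t ⊆ timeSlice T j)
    (hs : W.Regular (ξ s j) ∨ (ξ s j).mode = 0) : W.Regular (ξ t j) := by
  by_cases hmode : (ξ s j).mode = 0
  · have h1 := hξ.const j s (hsub ⟨le_rfl, hst.le⟩) t (hsub ⟨hst.le, le_rfl⟩)
    exact Or.inl ⟨h1.2.1 ▸ hmode, Or.inl (hξ.pos_mem_flowDest hst hsub hmode ⟨hst.le, le_rfl⟩)⟩
  · exact Or.inr (hξ.inManeuver_of_flow hW hst hsub ((hs.resolve_right hmode).inManeuver hmode))

/-- Induction on the number of jumps. Only the initial state can fail: a start in mode `0` inside an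
active region has to jump before it flows. -/
theorem regular (hW : W.Valid)
    (h0 : (ξ 0 0).mode = 0 ∨ ∃ s : State n b, s.mode = 0 ∧ ξ 0 0 ∈ W.jumpMap s) :
    ∀ j t, (t, j) ∈ T → W.Regular (ξ t j) ∨
      ((t, j) = (0, 0) ∧ (ξ 0 0).mode = 0 ∧ ξ 0 0 ∉ W.flowSet) := by
  intro j
  induction j with
  | zero =>
    intro t ht
    have hstart : W.Regular (ξ 0 0) ∨ ((ξ 0 0).mode = 0 ∧ ξ 0 0 ∉ W.flowSet) := by
      rcases h0 with h0 | ⟨s, hs, hjump⟩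
      · by_cases hf : ξ 0 0 ∈ W.flowSet
        · rcases hf with hf | hf
          · exact Or.inl (Or.inl ⟨h0, Or.inl hf.2⟩)
          · exact absurd h0 hf.1
        · exact Or.inr ⟨h0, hf⟩
      · exact Or.inl (Or.inr (inManeuver_of_mem_jumpMap hW hs hjump))
    obtain ⟨s, hst, hsub, hs0, -⟩ := hξ.domain.exists_start ht
    obtain rfl := hs0 rfl
    rcases hst.eq_or_lt with rfl | hst
    · exact hstart.imp_right fun h => ⟨rfl, h⟩
    · exact Or.inl (hξ.regular_of_flow hW hst hsub (hstart.imp_right And.left))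
  | succ i ih =>
    intro t ht
    obtain ⟨s, hst, hsub, -, hs⟩ := hξ.domain.exists_start ht
    have hi := hs i rfl
    obtain ⟨-, hmap⟩ := hξ.jump s i hi (hsub ⟨le_rfl, hst⟩)
    have hstart : W.Regular (ξ s (i + 1)) := by
      by_cases hmode : (ξ s i).mode = 0
      · exact Or.inr (inManeuver_of_mem_jumpMap hW hmode hmap)
      · rcases ih s hi with h1 | ⟨h1, h2, -⟩
        · obtain ⟨hpos, ⟨-, hj, -, hm, -⟩ | ⟨h2, -⟩⟩ := hmap
          · exact Or.inl ⟨hm, hpos ▸ (h1.inManeuver hmode).atMostEntering hW hj⟩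
          · exact absurd h2 hmode
        · simp only [Prod.mk.injEq] at h1
          rw [h1.1, h1.2] at hmode
          exact absurd h2 hmode
    rcases hst.eq_or_lt with rfl | hst
    · exact Or.inl hstart
    · exact Or.inl (hξ.regular_of_flow hW hst hsub (Or.inl hstart))

variable (hreg : ∀ j t, (t, j) ∈ T → W.Regular (ξ t j) ∨
  ((t, j) = (0, 0) ∧ (ξ 0 0).mode = 0 ∧ ξ 0 0 ∉ W.flowSet))
include hreg

omit hξ in
theorem inManeuver_of_regular {t : ℝ} {j : ℕ} (ht : (t, j) ∈ T) (hm : (ξ t j).mode ≠ 0) :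
    W.InManeuver (ξ t j) := by
  rcases hreg j t ht with h | ⟨h1, h2, -⟩
  · exact h.inManeuver hm
  · simp only [Prod.mk.injEq] at h1
    rw [h1.1, h1.2] at hm
    exact absurd h2 hm

/-- Over an initial slice of positive length, closedness of `flowDest` or the invariant of a
maneuver would put the initial state in the flow set. -/
theorem eq_zero_of_notMem_flowSet (hW : W.Valid) (h0 : ξ 0 0 ∉ W.flowSet) {t : ℝ}
    (ht : (t, 0) ∈ T) : t = 0 := by
  obtain ⟨s, hst, hsub, hs0, -⟩ := hξ.domain.exists_start ht
  obtain rfl := hs0 rfl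
  by_contra hne
  have hlt : 0 < t := lt_of_le_of_ne hst (Ne.symm hne)
  refine h0 ?_
  by_cases hmode : (ξ 0 0).mode = 0
  · exact Or.inl ⟨hmode, hξ.pos_mem_flowDest hlt hsub hmode ⟨le_rfl, hst⟩⟩
  · exact Or.inr ⟨hmode, (inManeuver_of_regular hreg (hsub ⟨le_rfl, hst⟩) hmode).mem_flowAvoid hW⟩

theorem continuousOn_velocity (hW : W.Valid) {j : ℕ} {s t : ℝ} (hst : s ≤ t)
    (hsub : Icc s t ⊆ timeSlice T j) : ContinuousOn (fun τ => W.velocity (ξ τ j)) (Icc s t) := by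
  have hpos := hξ.continuousOn_pos hst hsub
  by_cases hmode : (ξ s j).mode = 0
  · refine ((continuous_nominal (W := W)).comp_continuousOn hpos).congr fun τ hτ => ?_
    have h1 := hξ.const j s (hsub ⟨le_rfl, hst⟩) τ (hsub hτ)
    exact velocity_of_mode_eq_zero (h1.2.1 ▸ hmode)
  · have hmem : ∀ τ ∈ Icc s t,
        ξ τ j = ⟨(ξ τ j).pos, (ξ s j).obs, (ξ s j).mode, (ξ s j).vdest⟩ := by
      intro τ hτ
      obtain ⟨h1, h2, h3⟩ := hξ.const j s (hsub ⟨le_rfl, hst⟩) τ (hsub hτ)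
      rw [h1, h2, h3]
    refine ((Workspace.continuousOn_velocity (k := (ξ s j).obs) (z := (ξ s j).vdest) hW
      hmode).comp hpos fun τ hτ => ?_).congr fun τ hτ => congrArg W.velocity (hmem τ hτ)
    obtain ⟨h1, h2, h3⟩ := hξ.const j s (hsub ⟨le_rfl, hst⟩) τ (hsub hτ)
    have h4 := (inManeuver_of_regular hreg (hsub hτ) (h2 ▸ hmode)).mem_flowAvoid hW
    rw [← h1, ← h2, ← h3] at h4
    exact flowAvoid_subset_regularSet hW h4

/-- Exactly one side of the jump is in mode `0`, where the control is nominal; the other side is a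
maneuver at a boundary position, where the avoidance control is nominal too. -/
theorem velocity_jump (hW : W.Valid) {t : ℝ} {j : ℕ} (ht : (t, j) ∈ T) (ht' : (t, j + 1) ∈ T)
    (hne : (t, j) ≠ (0, 0) ∨ ξ 0 0 ∈ W.flowSet) :
    W.velocity (ξ t j) = W.velocity (ξ t (j + 1)) := by
  have hR : W.Regular (ξ t j) := (hreg j t ht).resolve_right fun h =>
    hne.elim (fun h1 => h1 h.1) h.2.2
  obtain ⟨-, hmap⟩ := hξ.jump t j ht ht'
  by_cases hmode : (ξ t j).mode = 0
  · have hM := inManeuver_of_mem_jumpMap hW hmode hmap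
    have hE : W.AtMostEntering (ξ t j).pos :=
      (hR.resolve_right fun h => h.mode_ne hmode).2
    rw [← hmap.1] at hE
    rw [velocity_of_mode_eq_zero hmode, hM.velocity_eq_nominal hW hE, hmap.1]
  · obtain ⟨hpos, ⟨-, hj, -, hm, -⟩ | ⟨h2, -⟩⟩ := hmap
    · rw [(hR.inManeuver hmode).velocity_eq_nominal_of_mem_jumpAvoid hW hj,
        velocity_of_mode_eq_zero hm, hpos]
    · exact absurd h2 hmode

end IsSolution

end Workspace

end HybridNav

end

theorem proposition1 {n b : ℕ} (hn : 2 ≤ n) (W : HybridNav.Workspace n b) (hW : W.Valid)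
    (T : Set (ℝ × ℕ)) (ξ : ℝ → ℕ → HybridNav.State n b) (hξ : W.IsSolution T ξ)
    (h0 : (ξ 0 0).mode = 0 ∨
      ∃ s : HybridNav.State n b, s.mode = 0 ∧ ξ 0 0 ∈ W.jumpMap s) :
    (∃ U : ℝ → HybridNav.Pt n,
      ContinuousOn U {t | ∃ j, (t, j) ∈ T} ∧
      ∀ t j, (t, j) ∈ T → ((t, j) ≠ (0, 0) ∨ ξ 0 0 ∈ W.flowSet) →
        W.velocity (ξ t j) = U t) ∧
    (∀ t j, (t, j) ∈ T → (ξ t j).mode ≠ 0 →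
      W.IsLocallyOptimal (ξ t j).pos (ξ t j).obs
        (W.kappa (ξ t j).pos (ξ t j).obs (ξ t j).vdest (ξ t j).mode) ∧
      (W.dist (ξ t j).pos (ξ t j).obs ≤ W.rbar (ξ t j).obs - W.ε →
        W.IsLocallyOptimal (ξ t j).pos (ξ t j).obs (W.velocity (ξ t j)))) := by
  have hreg := hξ.regular hW h0
  refine ⟨hξ.domain.exists_continuousOn (fun t j => W.velocity (ξ t j)) (ξ 0 0 ∈ W.flowSet)
    (fun h t ht => hξ.eq_zero_of_notMem_flowSet hreg hW h ht)
    (fun j s t hst hsub _ => hξ.continuousOn_velocity hreg hW hst hsub)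
    (fun t j ht ht' hne => hξ.velocity_jump hreg hW ht ht' hne), fun t j ht hm => ?_⟩
  obtain ⟨H, h, e₁, e₂, P, q, M⟩ :=
    HybridNav.Workspace.IsSolution.inManeuver_of_regular hreg ht hm
  exact ⟨M.isLocallyOptimal_kappa hW, M.isLocallyOptimal_velocity hW⟩
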